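/- Let $\mathbb A\subset\mathbb R^k$ (actions) and $\Theta\subset\mathbb R^l$ (parameters) be nonempty and compact, and let $\mathbb Y\subset\mathbb R^m$ (consequences) be Borel. Write $\Delta X$ for the Borel probability measures on $X$ with weak convergence. Let $Q(\cdot\mid a)$ be the true consequence kernel, $Q_\theta(\cdot\mid a)$, $\theta\in\Theta$, the agent's (possibly misspecified) model, a kernel from $\Theta\times\mathbb A$ to $\mathbb Y$, and $\pi:\mathbb A\times\mathbb Y\to\mathbb R$ the per-period payoff, measurable in $y$. Assume: * there is a $\sigma$-finite measure $\nu$ on $\mathbb Y$ and jointly measurable nonnegative densities $q(\cdot\mid a)=dQ(\cdot\mid a)/d\nu$, $q_\theta(\cdot\mid a)=dQ_\theta(\cdot\mid a)/d\nu$, such that for $\nu$-a.e. $y$ the maps $a\mapsto q(y\mid a)$, $(\theta,a)\mapsto q_\theta(y\mid a)$ and $a\mapsto\pi(a,y)$ are continuous; * there are measurable $M:\mathbb Y\to[1,\infty)$ and $r,h:\mathbb Y\to[0,\infty)$ such that for all $(\theta,a)$ and $\nu$-a.e. $y$: $q_\theta(y\mid a)M(y)^{-1}\le q(y\mid a)\le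 q_\theta(y\mid a)M(y)$, $q(y\mid a)\le r(y)$ and $|\pi(a,y)|\le h(y)$; moreover $\int M r\,d\nu<\infty$ and $\int h M r\,d\nu<\infty$. Define $U(a,\theta)=\int\pi(a,y)\,Q_\theta(dy\mid a)$, $F(\mu)=\arg\max_{a\in\mathbb A}\int U(a,\theta)\,\mu(d\theta)$ for $\mu\in\Delta\Theta$, $K(\theta,a)=\mathrm{KL}(Q(\cdot\mid a)\,\|\,Q_\theta(\cdot\mid a))$ and $\Theta^{\mathrm m}(\sigma)=\arg\min_{\theta\in\Theta}\int K(\theta,a)\,\sigma(da)$ for $\sigma\in\Delta\mathbb A$. The measure $\sigma$ is a (myopic) *Berk–Nash equilibrium* if there is $\mu\in\Delta\Theta$ with $\operatorname{supp}\sigma\subseteq F(\mu)$ and $\operatorname{supp}\mu\subseteq\Theta^{\mathrm m}(\sigma)$. *Weak Identification* holds at $\sigma$ if $Q_\theta(\cdot\mid a)=Q_{\theta'}(\cdot\mid a)$ for all $\theta,\theta'\in\Theta^{\mathrm m}(\sigma)$ and all $a\in\operatorname{supp}\sigma$. Let $B(a,y,\mu)$ be the Bayesian update of $\mu$ after consequence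 $y$ of action $a$, i.e. the probability measure with density proportional to $\theta\mapsto q_\theta(y\mid a)$ with respect to $\mu$ (equal to $\mu$ where this is undefined), and let $\bar Q_\mu(\cdot\mid a)=\int Q_\theta(\cdot\mid a)\,\mu(d\theta)$. Let $\delta\in(0,1)$. Then there is exactly one bounded measurable $W:\Delta\Theta\to\mathbb R$ such that for every $\mu$ $$W(\mu)=\max_{a\in\mathbb A}\int_{\mathbb Y}\bigl(\pi(a,y)+\delta\,W(B(a,y,\mu))\bigr)\,\bar Q_\mu(dy\mid a)$$ (with the maximum attained). Let $F_\delta(\mu)$ be the set of maximizers in this equation. Consider a forward-looking agent: fix a full-support prior $\mu_0\in\Delta\Theta$ and choice kernels $\phi_t$ from $\Delta\Theta$ to $\mathbb A$ with $\phi_t(F_\delta(\mu)\mid\mu)=1$ for all $t\ge 0$ and $\mu\in\Delta\Theta$. In each period $t=0,1,2,\dots$, given the belief $\mu_t$, an action $a_t\sim\phi_t(\cdot\mid\mu_t)$ is drawn, then a consequence $y_t\sim Q(\cdot\mid a_t)$, and $\mu_{t+1}=B(a_t,y_t,\mu_t)$. Let $\mathbf P$ be the resulting law on infinite paths, and for $t\ge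 1$ let $\sigma_t=\frac1t\sum_{\tau<t}\delta_{a_\tau}$ be the empirical distribution of the first $t$ actions. Then, $\mathbf P$-almost surely, the following holds for every $\sigma\in\Delta\mathbb A$: if $\sigma_t\to\sigma$ weakly and Weak Identification holds at $\sigma$, then $\sigma$ is a Berk–Nash equilibrium. -/

import Mathlib

open MeasureTheory ProbabilityTheory Filter Topology
open scoped ENNReal NNReal

/-- The primitives of the single-agent problem: actions `A`, parameters `Θ`, consequences `Y`,
the true consequence kernel `Q`, the parametric model `Qm` (`Qm (θ, a) = Q_θ(· ∣ a)`), the payoff,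
and densities of all the kernels with respect to a common σ-finite measure `ν`. -/
structure LearningProblem (A Θ Y : Type*) [MeasurableSpace A] [MeasurableSpace Θ]
    [MeasurableSpace Y] where
  /-- true consequence kernel -/
  Q : Kernel A Y
  /-- the agent's model -/
  Qm : Kernel (Θ × A) Y
  /-- per-period payoff -/
  payoff : A → Y → ℝ
  /-- dominating measure -/
  ν : Measure Y
  /-- true density `q(y ∣ a)` -/
  q : A → Y → ℝ≥0
  /-- model density `q_θ(y ∣ a)` -/
  qm : Θ → A → Y → ℝ≥0
  markov_Q : IsMarkovKernel Q
  markov_Qm : IsMarkovKernel Qm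
  measurable_payoff : ∀ a, Measurable (payoff a)
  sigmaFinite : SigmaFinite ν
  measurable_q : Measurable fun p : A × Y => q p.1 p.2
  measurable_qm : Measurable fun p : Θ × A × Y => qm p.1 p.2.1 p.2.2
  Q_eq : ∀ a, Q a = ν.withDensity fun y => (q a y : ℝ≥0∞)
  Qm_eq : ∀ θ a, Qm (θ, a) = ν.withDensity fun y => (qm θ a y : ℝ≥0∞)

namespace LearningProblem

/-- The regularity conditions on densities and payoff: almost everywhere continuity, the
likelihood-ratio envelope, and domination of the payoff. -/
structure Regular {A Θ Y : Type*} [TopologicalSpace A] [MeasurableSpace A] [TopologicalSpace Θ]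
    [MeasurableSpace Θ] [MeasurableSpace Y] (E : LearningProblem A Θ Y) : Prop where
  continuous_q : ∀ᵐ y ∂E.ν, Continuous fun a => E.q a y
  continuous_qm : ∀ᵐ y ∂E.ν, Continuous fun p : Θ × A => E.qm p.1 p.2 y
  continuous_payoff : ∀ᵐ y ∂E.ν, Continuous fun a => E.payoff a y
  envelope : ∃ M r h : Y → ℝ≥0, Measurable M ∧ Measurable r ∧ Measurable h ∧
    (∀ y, 1 ≤ M y) ∧
    (∀ θ a, ∀ᵐ y ∂E.ν, E.qm θ a y * (M y)⁻¹ ≤ E.q a y ∧ E.q a y ≤ E.qm θ a y * M y) ∧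
    (∀ a, ∀ᵐ y ∂E.ν, E.q a y ≤ r y) ∧
    ∫⁻ y, (M y : ℝ≥0∞) * r y ∂E.ν < ∞ ∧
    (∀ a, ∀ᵐ y ∂E.ν, |E.payoff a y| ≤ h y) ∧
    ∫⁻ y, (h y : ℝ≥0∞) * M y * r y ∂E.ν < ∞

variable {A Θ Y : Type*} [MeasurableSpace A] [MeasurableSpace Θ] [MeasurableSpace Y]

/-! ### Static notions -/

/-- `U(a, θ) = ∫ π(a, y) Q_θ(dy ∣ a)`. -/
noncomputable def expectedPayoff (E : LearningProblem A Θ Y) (a : A) (θ : Θ) : ℝ :=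
  ∫ y, E.payoff a y ∂(E.Qm (θ, a))

/-- The myopic optimality correspondence `F(μ)`. -/
def myopicOptimal (E : LearningProblem A Θ Y) (μ : ProbabilityMeasure Θ) : Set A :=
  {a | ∀ a', ∫ θ, E.expectedPayoff a' θ ∂(μ : Measure Θ) ≤
    ∫ θ, E.expectedPayoff a θ ∂(μ : Measure Θ)}

/-- `K(θ, a) = KL(Q(· ∣ a) ‖ Q_θ(· ∣ a))`. -/
noncomputable def kl (E : LearningProblem A Θ Y) (θ : Θ) (a : A) : ℝ≥0∞ :=
  InformationTheory.klDiv (E.Q a) (E.Qm (θ, a))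

/-- The set `Θᵐ(σ)` of minimizers of `θ ↦ ∫ K(θ, a) σ(da)`. -/
def klMinimizers (E : LearningProblem A Θ Y) (σ : ProbabilityMeasure A) : Set Θ :=
  {θ | ∀ θ', ∫⁻ a, E.kl θ a ∂(σ : Measure A) ≤ ∫⁻ a, E.kl θ' a ∂(σ : Measure A)}

/-- (Myopic) Berk–Nash equilibrium. -/
def IsBerkNash [TopologicalSpace A] [TopologicalSpace Θ] (E : LearningProblem A Θ Y)
    (σ : ProbabilityMeasure A) : Prop :=
  ∃ μ : ProbabilityMeasure Θ,
    (σ : Measure A).support ⊆ E.myopicOptimal μ ∧ (μ : Measure Θ).support ⊆ E.klMinimizers σ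

/-- Weak Identification at `σ`. -/
def WeakIdentification [TopologicalSpace A] (E : LearningProblem A Θ Y)
    (σ : ProbabilityMeasure A) : Prop :=
  ∀ θ ∈ E.klMinimizers σ, ∀ θ' ∈ E.klMinimizers σ, ∀ a ∈ (σ : Measure A).support,
    E.Qm (θ, a) = E.Qm (θ', a)

/-! ### Bayesian updating -/

/-- The measure `B ↦ ∫_B q_θ(y ∣ a) μ(dθ)`. -/
noncomputable def likelihoodMeasure (E : LearningProblem A Θ Y) (μ : ProbabilityMeasure Θ) (a : A)
    (y : Y) : Measure Θ :=
  (μ : Measure Θ).withDensity fun θ => (E.qm θ a y : ℝ≥0∞)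

open Classical in
/-- The posterior as a measure, `B ↦ ∫_B q_θ(y ∣ a) μ(dθ) / ∫_Θ q_θ(y ∣ a) μ(dθ)`. Where Bayes' rule
is undefined (zero or infinite normalizing constant), the belief is left unchanged. -/
noncomputable def posterior (E : LearningProblem A Θ Y) (μ : ProbabilityMeasure Θ) (a : A) (y : Y) :
    Measure Θ :=
  if E.likelihoodMeasure μ a y Set.univ ≠ 0 ∧ E.likelihoodMeasure μ a y Set.univ ≠ ∞ then
    (E.likelihoodMeasure μ a y Set.univ)⁻¹ • E.likelihoodMeasure μ a y
  else (μ : Measure Θ)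

theorem isProbabilityMeasure_posterior (E : LearningProblem A Θ Y) (μ : ProbabilityMeasure Θ)
    (a : A) (y : Y) : IsProbabilityMeasure (E.posterior μ a y) := by
  unfold posterior
  split_ifs with h
  · exact ⟨by simpa using ENNReal.inv_mul_cancel h.1 h.2⟩
  · infer_instance

/-- The Bayesian update `B(a, y, μ)`. -/
noncomputable def bayes (E : LearningProblem A Θ Y) (μ : ProbabilityMeasure Θ) (a : A) (y : Y) :
    ProbabilityMeasure Θ :=
  ⟨E.posterior μ a y, E.isProbabilityMeasure_posterior μ a y⟩

theorem measurable_likelihoodMeasure (E : LearningProblem A Θ Y) :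
    Measurable fun p : ProbabilityMeasure Θ × A × Y => E.likelihoodMeasure p.1 p.2.1 p.2.2 := by
  let κ : Kernel (ProbabilityMeasure Θ × A × Y) Θ :=
    ⟨fun p => (p.1 : Measure Θ), measurable_subtype_coe.comp measurable_fst⟩
  have : IsMarkovKernel κ := ⟨fun p => inferInstanceAs (IsProbabilityMeasure (p.1 : Measure Θ))⟩
  refine Measure.measurable_of_measurable_coe _ fun s hs => ?_
  have h1 : Measurable (Function.uncurry fun (p : ProbabilityMeasure Θ × A × Y) (θ : Θ) =>
      s.indicator (fun θ => (E.qm θ p.2.1 p.2.2 : ℝ≥0∞)) θ) := by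
    have h2 : Measurable fun z : (ProbabilityMeasure Θ × A × Y) × Θ =>
        (E.qm z.2 z.1.2.1 z.1.2.2 : ℝ≥0∞) :=
      measurable_coe_nnreal_ennreal.comp (E.measurable_qm.comp
        (measurable_snd.prodMk (measurable_snd.comp measurable_fst)))
    have h3 := h2.indicator (measurable_snd hs)
    exact h3
  have h4 := h1.lintegral_kernel_prod_right (κ := κ)
  have h5 : (fun p : ProbabilityMeasure Θ × A × Y => E.likelihoodMeasure p.1 p.2.1 p.2.2 s) =
      fun p => ∫⁻ θ, s.indicator (fun θ => (E.qm θ p.2.1 p.2.2 : ℝ≥0∞)) θ ∂κ p := by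
    funext p
    simp only [likelihoodMeasure]
    rw [withDensity_apply _ hs, ← lintegral_indicator hs]
    rfl
  rw [h5]
  exact h4

theorem measurable_bayes (E : LearningProblem A Θ Y) :
    Measurable fun p : ProbabilityMeasure Θ × A × Y => E.bayes p.1 p.2.1 p.2.2 := by
  classical
  have hm := E.measurable_likelihoodMeasure
  have hZ : Measurable fun p : ProbabilityMeasure Θ × A × Y =>
      E.likelihoodMeasure p.1 p.2.1 p.2.2 Set.univ :=
    (Measure.measurable_coe MeasurableSet.univ).comp hm
  refine Measurable.subtype_mk (p := fun μ : Measure Θ => IsProbabilityMeasure μ)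
    (f := fun p : ProbabilityMeasure Θ × A × Y => (E.bayes p.1 p.2.1 p.2.2 : Measure Θ)) ?_
  change Measurable fun p : ProbabilityMeasure Θ × A × Y => E.posterior p.1 p.2.1 p.2.2
  unfold posterior
  refine Measurable.ite ?_ ?_ (measurable_subtype_coe.comp measurable_fst)
  · exact (hZ (measurableSet_singleton 0).compl).inter (hZ (measurableSet_singleton ∞).compl)
  · refine Measure.measurable_of_measurable_coe _ fun s hs => ?_
    simp only [Measure.smul_apply, smul_eq_mul]
    exact hZ.inv.mul ((Measure.measurable_coe hs).comp hm)

/-! ### The forward-looking agent -/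

/-- The predictive distribution `Q̄_μ(· ∣ a) = ∫ Q_θ(· ∣ a) μ(dθ)`. -/
noncomputable def predictive (E : LearningProblem A Θ Y) (μ : ProbabilityMeasure Θ) (a : A) :
    Measure Y :=
  (μ : Measure Θ).bind fun θ => E.Qm (θ, a)

/-- `∫ (π(a, y) + δ W(B(a, y, μ))) Q̄_μ(dy ∣ a)`. -/
noncomputable def dynamicPayoff (E : LearningProblem A Θ Y) (δ : ℝ)
    (W : ProbabilityMeasure Θ → ℝ) (μ : ProbabilityMeasure Θ) (a : A) : ℝ :=
  ∫ y, (E.payoff a y + δ * W (E.bayes μ a y)) ∂(E.predictive μ a)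

/-- `W` is the value function: a bounded measurable solution of the Bellman equation
`W(μ) = max_a ∫ (π(a, y) + δ W(B(a, y, μ))) Q̄_μ(dy ∣ a)`. -/
structure IsValueFunction (E : LearningProblem A Θ Y) (δ : ℝ)
    (W : ProbabilityMeasure Θ → ℝ) : Prop where
  measurable : Measurable W
  bounded : ∃ C, ∀ μ, |W μ| ≤ C
  bellman : ∀ μ, IsGreatest (Set.range (E.dynamicPayoff δ W μ)) (W μ)

/-- The optimal-action correspondence `F_δ(μ)` computed from the value function `W`. -/
def dynamicOptimal (E : LearningProblem A Θ Y) (δ : ℝ) (W : ProbabilityMeasure Θ → ℝ)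
    (μ : ProbabilityMeasure Θ) : Set A :=
  {a | ∀ a', E.dynamicPayoff δ W μ a' ≤ E.dynamicPayoff δ W μ a}

/-! ### Dynamics

A period is recorded as a triple (belief, action, consequence). -/

/-- One period: given the belief `μ`, the action is drawn from the choice rule `ψ(· ∣ μ)`, then the
consequence from the true kernel; the result is (belief, action, consequence). -/
noncomputable def period (E : LearningProblem A Θ Y) (ψ : Kernel (ProbabilityMeasure Θ) A) :
    Kernel (ProbabilityMeasure Θ) (ProbabilityMeasure Θ × A × Y) :=
  Kernel.id ×ₖ (ψ ⊗ₖ Kernel.prodMkLeft (ProbabilityMeasure Θ) E.Q)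

/-- The law of period `t + 1` given the history up to period `t`: the belief is updated by Bayes'
rule from the last period, then action and consequence are drawn using the rule `φ (t + 1)`. -/
noncomputable def transition (E : LearningProblem A Θ Y)
    (φ : ℕ → Kernel (ProbabilityMeasure Θ) A) (t : ℕ) :
    Kernel ((i : Finset.Iic t) → ProbabilityMeasure Θ × A × Y) (ProbabilityMeasure Θ × A × Y) :=
  (E.period (φ (t + 1))).comap
    (fun x => E.bayes (x ⟨t, Finset.mem_Iic.2 le_rfl⟩).1 (x ⟨t, Finset.mem_Iic.2 le_rfl⟩).2.1
      (x ⟨t, Finset.mem_Iic.2 le_rfl⟩).2.2)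
    (E.measurable_bayes.comp (measurable_pi_apply _))

instance (E : LearningProblem A Θ Y) : IsMarkovKernel E.Q := E.markov_Q

instance (E : LearningProblem A Θ Y) : IsMarkovKernel E.Qm := E.markov_Qm

instance (E : LearningProblem A Θ Y) (ψ : Kernel (ProbabilityMeasure Θ) A) [IsMarkovKernel ψ] :
    IsMarkovKernel (E.period ψ) := by
  unfold period; infer_instance

instance (E : LearningProblem A Θ Y) (φ : ℕ → Kernel (ProbabilityMeasure Θ) A)
    [∀ t, IsMarkovKernel (φ t)] (t : ℕ) : IsMarkovKernel (E.transition φ t) := by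
  unfold transition; infer_instance

/-- The probability law `𝐏` on infinite paths induced by the prior `μ₀`, the choice rules `φ` and
the true kernel. -/
noncomputable def pathLaw (E : LearningProblem A Θ Y) (φ : ℕ → Kernel (ProbabilityMeasure Θ) A)
    [∀ t, IsMarkovKernel (φ t)] (μ₀ : ProbabilityMeasure Θ) :
    Measure (ℕ → ProbabilityMeasure Θ × A × Y) :=
  Kernel.trajMeasure (X := fun _ => ProbabilityMeasure Θ × A × Y) (E.period (φ 0) μ₀)
    (E.transition φ)

end LearningProblem

/-- The empirical distribution of the first `t + 1` terms `a 0, …, a t` of a sequence. -/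
noncomputable def empiricalDistribution {A : Type*} [MeasurableSpace A] (a : ℕ → A) (t : ℕ) :
    ProbabilityMeasure A :=
  ⟨((t : ℝ≥0∞) + 1)⁻¹ • ∑ i ∈ Finset.range (t + 1), Measure.dirac (a i), ⟨by
    simpa using ENNReal.inv_mul_cancel (a := (t : ℝ≥0∞) + 1) (by simp) (by simp)⟩⟩

/-! Along a path, the belief after `n` periods has density proportional to `exp (-∑ log (q / q_θ))`
with respect to the prior. The log-likelihood ratios are bounded by `log M`, and `(log M)^2 ≤ 4 M`,
so integrability of `M r` alone bounds their second moments uniformly in the action. Centred at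
their conditional means they are orthogonal, and a strong law for orthogonal variables applies.
Doing this for a countable dense set of parameters and for countably many oscillation functions
gives one null set, independent of `σ`. Off it, whenever the empirical distributions converge to
`σ`, the normalized log-likelihood ratio converges to `∫ K(θ, a) σ(da)` uniformly in `θ`
(`IsTypical.eventually_abs_sub_lt`). Since the prior charges open sets, posterior mass away from the
minimizers vanishes exponentially, and every limit belief is carried by `Θᵐ(σ)`.

The Bellman operator preserves continuity and contracts, and the bounded measurable solution is
unique; hence `W` is continuous and `F_δ` has closed graph. An action `b` in the support of `σ` is a
cluster point of the actions played, so by compactness `b ∈ F_δ(μ)` for some limit belief `μ`. Weak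
Identification makes `b` uninformative under `μ`: the posterior stays at `μ`, and `W(μ) = U(b, μ) +
δ W(μ)`. Repeating any `a'` forever is feasible, so `U(a', μ) ≤ (1 - δ) W(μ) = U(b, μ)`, and `b` is
myopically optimal (`mem_myopicOptimal`).

The belief `μ` found this way depends on `b`. But for `b` in the support, `U(b, ·)` is constant on
`Θᵐ(σ)`, so these actions have the same payoffs under all such beliefs, and one belief supports all
of `σ` (`isBerkNash_of_tendsto`). -/

set_option linter.unusedSectionVars false

/-! ### Weak convergence of probability measures -/

/-- Evaluations against bounded continuous functions generate the weak topology and are measurable,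
so weakly open sets of probability measures are measurable. -/
instance ProbabilityMeasure.opensMeasurableSpace {X : Type*} [MetricSpace X] [CompactSpace X]
    [MeasurableSpace X] [BorelSpace X] : OpensMeasurableSpace (ProbabilityMeasure X) := by
  -- Compactness and metrizability of the weak topology give the second countability under which a
  -- subbasis generates the Borel sets.
  let := TopologicalSpace.metrizableSpaceMetric (ProbabilityMeasure X)
  set s : Set (Set (ProbabilityMeasure X)) :=
    {t | ∃ (f : BoundedContinuousFunction X ℝ≥0) (U : Set ℝ≥0∞), IsOpen U ∧
      t = (fun μ : ProbabilityMeasure X => ∫⁻ x, f x ∂(μ : Measure X)) ⁻¹' U} with hs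
  have hle : (inferInstance : TopologicalSpace (ProbabilityMeasure X)) =
      TopologicalSpace.generateFrom s := by
    refine le_antisymm (le_generateFrom ?_) ?_
    · rintro t ⟨f, U, hU, rfl⟩
      refine hU.preimage (continuous_iff_continuousAt.2 fun μ => ?_)
      exact (ProbabilityMeasure.tendsto_iff_forall_lintegral_tendsto.1 tendsto_id) f
    · rw [← continuous_id_iff_le]
      refine (@continuous_iff_continuousAt _ _ (_) (_) _).2 fun μ => ?_
      refine ProbabilityMeasure.tendsto_iff_forall_lintegral_tendsto.2 fun f => ?_
      have : @Continuous _ _ (TopologicalSpace.generateFrom s) _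
          (fun μ : ProbabilityMeasure X => ∫⁻ x, f x ∂(μ : Measure X)) :=
        (@continuous_def _ _ (_) _ _).2 fun U hU => TopologicalSpace.isOpen_generateFrom_of_mem ⟨f, U, hU, rfl⟩
      exact (@Continuous.continuousAt _ _ (_) _ _ _ this)
  refine ⟨?_⟩
  rw [borel_eq_generateFrom_of_subbasis hle]
  refine MeasurableSpace.generateFrom_le ?_
  rintro t ⟨f, U, hU, rfl⟩
  exact ((Measure.measurable_lintegral (f := fun x => (f x : ℝ≥0∞)) (by fun_prop)).comp
    measurable_subtype_coe) hU.measurableSet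

/-- The integral of a jointly continuous function is jointly continuous in the measure and the
parameter. -/
theorem ProbabilityMeasure.continuous_integral_prod {X Z : Type*} [MetricSpace X] [CompactSpace X]
    [MeasurableSpace X] [BorelSpace X] [TopologicalSpace Z] {f : X → Z → ℝ}
    (hf : Continuous fun p : X × Z => f p.1 p.2) :
    Continuous fun p : ProbabilityMeasure X × Z => ∫ x, f x p.2 ∂(p.1 : Measure X) := by
  -- Currying turns joint continuity into sup-norm continuity in `z`. The integral then splits into
  -- a fixed integrand, handled by weak convergence, and an error bounded by a norm whatever the
  -- measure.
  let F : C(Z, C(X, ℝ)) := ContinuousMap.curry ⟨fun p : Z × X => f p.2 p.1, by fun_prop⟩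
  refine continuous_iff_continuousAt.2 fun ⟨μ₀, z₀⟩ => ?_
  have h1 : Tendsto (fun p : ProbabilityMeasure X × Z => ∫ x, F z₀ x ∂(p.1 : Measure X))
      (𝓝 (μ₀, z₀)) (𝓝 (∫ x, F z₀ x ∂(μ₀ : Measure X))) :=
    (ProbabilityMeasure.tendsto_iff_forall_integral_tendsto.1
      (continuous_fst.tendsto (μ₀, z₀))) (BoundedContinuousFunction.mkOfCompact (F z₀))
  have h2 : Tendsto (fun p : ProbabilityMeasure X × Z => ∫ x, (F p.2 - F z₀) x ∂(p.1 : Measure X))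
      (𝓝 (μ₀, z₀)) (𝓝 0) := by
    have h3 : Tendsto (fun p : ProbabilityMeasure X × Z => ‖F p.2 - F z₀‖) (𝓝 (μ₀, z₀)) (𝓝 0) := by
      have : Continuous fun p : ProbabilityMeasure X × Z => ‖F p.2 - F z₀‖ := by fun_prop
      simpa using this.tendsto (μ₀, z₀)
    refine squeeze_zero_norm (fun p => ?_) h3
    have := norm_integral_le_of_norm_le_const (μ := (p.1 : Measure X))
      (Eventually.of_forall fun x => ContinuousMap.norm_coe_le_norm (F p.2 - F z₀) x)
    simpa using this
  have h4 := h1.add h2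
  rw [add_zero] at h4
  refine h4.congr fun p => ?_
  have hi : ∀ g : C(X, ℝ), Integrable g (p.1 : Measure X) := fun g =>
    (BoundedContinuousFunction.mkOfCompact g).integrable _
  rw [← integral_add (hi _) (hi _)]
  exact integral_congr_ae (Eventually.of_forall fun x => by simp [F])

namespace LearningProblem

/-! ### Marginal likelihood and predictive distribution -/

section Measurability

variable {A Θ Y : Type*} [MeasurableSpace A] [MeasurableSpace Θ] [MeasurableSpace Y]

/-- The marginal likelihood `∫ q_θ(y ∣ a) μ(dθ)`. -/
noncomputable def evidence (E : LearningProblem A Θ Y) (μ : ProbabilityMeasure Θ) (a : A) (y : Y) :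
    ℝ≥0 :=
  (E.likelihoodMeasure μ a y Set.univ).toNNReal

theorem measurable_evidence (E : LearningProblem A Θ Y) :
    Measurable fun p : ProbabilityMeasure Θ × A × Y => E.evidence p.1 p.2.1 p.2.2 :=
  ((Measure.measurable_coe MeasurableSet.univ).comp E.measurable_likelihoodMeasure).ennreal_toNNReal

theorem measurable_evidence_right (E : LearningProblem A Θ Y) (μ : ProbabilityMeasure Θ) (a : A) :
    Measurable (E.evidence μ a) :=
  E.measurable_evidence.comp (g := fun p : ProbabilityMeasure Θ × A × Y => E.evidence p.1 p.2.1 p.2.2)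
    (f := fun y => (μ, a, y)) (measurable_const.prodMk (measurable_const.prodMk measurable_id))

theorem measurable_bayes_right (E : LearningProblem A Θ Y) (μ : ProbabilityMeasure Θ) (a : A) :
    Measurable (E.bayes μ a) :=
  E.measurable_bayes.comp (g := fun p : ProbabilityMeasure Θ × A × Y => E.bayes p.1 p.2.1 p.2.2)
    (f := fun y => (μ, a, y)) (measurable_const.prodMk (measurable_const.prodMk measurable_id))

theorem measurable_q_right (E : LearningProblem A Θ Y) (a : A) : Measurable (E.q a) :=
  E.measurable_q.comp (measurable_const.prodMk measurable_id)

theorem measurable_qm_right (E : LearningProblem A Θ Y) (θ : Θ) (a : A) : Measurable (E.qm θ a) :=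
  E.measurable_qm.comp (measurable_const.prodMk (measurable_const.prodMk measurable_id))

theorem measurable_qm_left (E : LearningProblem A Θ Y) (a : A) (y : Y) :
    Measurable fun θ => E.qm θ a y :=
  E.measurable_qm.comp (measurable_id.prodMk (measurable_const.prodMk measurable_const))

theorem likelihoodMeasure_univ (E : LearningProblem A Θ Y) (μ : ProbabilityMeasure Θ) (a : A)
    (y : Y) : E.likelihoodMeasure μ a y Set.univ = ∫⁻ θ, E.qm θ a y ∂(μ : Measure Θ) := by
  simp [likelihoodMeasure, withDensity_apply _ MeasurableSet.univ]

theorem evidence_eq_integral (E : LearningProblem A Θ Y) (μ : ProbabilityMeasure Θ) (a : A)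
    (y : Y) : (E.evidence μ a y : ℝ) = ∫ θ, (E.qm θ a y : ℝ) ∂(μ : Measure Θ) := by
  rw [integral_eq_lintegral_of_nonneg_ae (Eventually.of_forall fun θ => NNReal.coe_nonneg _)
    (E.measurable_qm_left a y).coe_nnreal_real.aestronglyMeasurable, evidence,
    likelihoodMeasure_univ]
  simp [ENNReal.toReal]

theorem isProbabilityMeasure_predictive (E : LearningProblem A Θ Y) (μ : ProbabilityMeasure Θ)
    (a : A) : IsProbabilityMeasure (E.predictive μ a) := by
  have hm : Measurable fun θ => E.Qm (θ, a) :=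
    E.Qm.measurable.comp (measurable_id.prodMk measurable_const)
  refine ⟨?_⟩
  rw [predictive, Measure.bind_apply MeasurableSet.univ hm.aemeasurable]
  simp

end Measurability

/-! ### Uniform regularity; continuity of Bayes' rule and of the dynamic payoff -/

/-- Regularity data on a measurable set of consequences of full measure, on which continuity and
the bounds hold for all actions and parameters simultaneously. -/
structure Envelope {A Θ Y : Type*} [TopologicalSpace A] [MeasurableSpace A] [TopologicalSpace Θ]
    [MeasurableSpace Θ] [MeasurableSpace Y] (E : LearningProblem A Θ Y) where
  /-- the set of regular consequences -/
  G : Set Y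
  /-- bound of the likelihood ratios -/
  M : Y → ℝ≥0
  /-- bound of the true density -/
  r : Y → ℝ≥0
  /-- bound of the payoff -/
  h : Y → ℝ≥0
  measurableSet_G : MeasurableSet G
  ae_mem : ∀ᵐ y ∂E.ν, y ∈ G
  measurable_M : Measurable M
  measurable_r : Measurable r
  measurable_h : Measurable h
  one_le_M : ∀ y, 1 ≤ M y
  continuous_q : ∀ y ∈ G, Continuous fun a => E.q a y
  continuous_qm : ∀ y ∈ G, Continuous fun p : Θ × A => E.qm p.1 p.2 y
  continuous_payoff : ∀ y ∈ G, Continuous fun a => E.payoff a y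
  qm_le : ∀ y ∈ G, ∀ θ a, E.qm θ a y ≤ E.q a y * M y
  q_le_qm : ∀ y ∈ G, ∀ θ a, E.q a y ≤ E.qm θ a y * M y
  q_le : ∀ y ∈ G, ∀ a, E.q a y ≤ r y
  payoff_le : ∀ y ∈ G, ∀ a, |E.payoff a y| ≤ h y
  integrable_M_r : Integrable (fun y => (M y * r y : ℝ)) E.ν
  integrable_h_M_r : Integrable (fun y => (h y * M y * r y : ℝ)) E.ν

variable {A Θ Y : Type*} [MetricSpace A] [CompactSpace A] [MeasurableSpace A] [BorelSpace A]
  [MetricSpace Θ] [CompactSpace Θ] [MeasurableSpace Θ] [BorelSpace Θ] [MeasurableSpace Y]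
  {E : LearningProblem A Θ Y}

/-- Countably many null sets suffice for a dense sequence of points; closedness extends the property
to all points. -/
theorem ae_forall_of_isClosed {X Z : Type*} [TopologicalSpace X] [TopologicalSpace.SeparableSpace X]
    [MeasurableSpace Z] {ν : Measure Z} {p : X → Z → Prop} (hc : ∀ᵐ y ∂ν, IsClosed {x | p x y})
    (hp : ∀ x, ∀ᵐ y ∂ν, p x y) : ∀ᵐ y ∂ν, ∀ x, p x y := by
  obtain ⟨s, hs, hd⟩ := TopologicalSpace.exists_countable_dense X
  filter_upwards [hc, (ae_ball_iff hs).2 fun x _ => hp x] with y hy1 hy2 x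
  have : closure s ⊆ {x | p x y} := hy1.closure_subset_iff.2 fun x hx => hy2 x hx
  exact this (hd x)

/-- In `Regular` the exceptional null sets of the bounds depend on the action and the parameter.
Each bound is a closed condition by continuity of the densities and the payoff, so separability
removes this dependence. -/
theorem Regular.nonempty_envelope (hE : E.Regular) : Nonempty E.Envelope := by
  obtain ⟨M, r, h, hM, hr, hh, hM1, hMq, hqr, hMr, hph, hhMr⟩ := hE.envelope
  have e1 : ∀ᵐ y ∂E.ν, ∀ p : Θ × A,
      E.qm p.1 p.2 y ≤ E.q p.2 y * M y ∧ E.q p.2 y ≤ E.qm p.1 p.2 y * M y := by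
    refine ae_forall_of_isClosed ?_ fun p => ?_
    · filter_upwards [hE.continuous_q, hE.continuous_qm] with y h1 h2
      have h3 : Continuous fun p : Θ × A => E.q p.2 y := h1.comp continuous_snd
      have c1 : IsClosed {p : Θ × A | E.qm p.1 p.2 y ≤ E.q p.2 y * M y} :=
        isClosed_le h2 (h3.mul continuous_const)
      have c2 : IsClosed {p : Θ × A | E.q p.2 y ≤ E.qm p.1 p.2 y * M y} :=
        isClosed_le h3 (h2.mul continuous_const)
      exact c1.inter c2
    · filter_upwards [hMq p.1 p.2] with y hy
      have := hM1 y
      refine ⟨?_, hy.2⟩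
      rw [← div_eq_mul_inv] at hy
      exact (div_le_iff₀ (lt_of_lt_of_le one_pos this)).1 hy.1
  have e2 : ∀ᵐ y ∂E.ν, ∀ a, E.q a y ≤ r y := by
    refine ae_forall_of_isClosed ?_ hqr
    filter_upwards [hE.continuous_q] with y h1
    exact isClosed_le h1 continuous_const
  have e3 : ∀ᵐ y ∂E.ν, ∀ a, |E.payoff a y| ≤ h y := by
    refine ae_forall_of_isClosed ?_ hph
    filter_upwards [hE.continuous_payoff] with y h1
    exact isClosed_le h1.abs continuous_const
  have e := hE.continuous_q.and (hE.continuous_qm.and (hE.continuous_payoff.and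
    (e1.and (e2.and e3))))
  obtain ⟨N, hN, hNm, hN0⟩ := exists_measurable_superset_of_null e
  have hG : ∀ y ∈ Nᶜ, _ := fun y hy => not_not.1 fun h => hy (hN h)
  refine ⟨⟨Nᶜ, M, r, h, hNm.compl, compl_mem_ae_iff.2 hN0, hM, hr, hh, hM1, fun y hy => (hG y hy).1,
    fun y hy => (hG y hy).2.1, fun y hy => (hG y hy).2.2.1,
    fun y hy θ a => ((hG y hy).2.2.2.1 (θ, a)).1, fun y hy θ a => ((hG y hy).2.2.2.1 (θ, a)).2,
    fun y hy => (hG y hy).2.2.2.2.1, fun y hy => (hG y hy).2.2.2.2.2, ⟨?_, ?_⟩, ⟨?_, ?_⟩⟩⟩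
  · fun_prop
  · simpa [HasFiniteIntegral, enorm_mul] using hMr
  · fun_prop
  · simpa [HasFiniteIntegral, enorm_mul] using hhMr

/-- Upper bound of the model densities. -/
theorem Envelope.qm_le_M_r (V : E.Envelope) {y : Y} (hy : y ∈ V.G) (θ : Θ) (a : A) :
    E.qm θ a y ≤ V.M y * V.r y := by
  refine (V.qm_le y hy θ a).trans ?_
  rw [mul_comm]
  gcongr
  exact V.q_le y hy a

theorem Envelope.likelihoodMeasure_univ_le (V : E.Envelope) {y : Y} (hy : y ∈ V.G)
    (μ : ProbabilityMeasure Θ) (a : A) :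
    E.likelihoodMeasure μ a y Set.univ ≤ (V.M y * V.r y : ℝ≥0) := by
  rw [likelihoodMeasure_univ]
  refine (lintegral_mono fun θ => ENNReal.coe_le_coe.2 (V.qm_le_M_r hy θ a)).trans ?_
  simp

/-- `evidence` is a `toNNReal`, faithful only where the likelihood mass is finite; the envelope
guarantees this on `G`. -/
theorem Envelope.coe_evidence (V : E.Envelope) {y : Y} (hy : y ∈ V.G)
    (μ : ProbabilityMeasure Θ) (a : A) :
    (E.evidence μ a y : ℝ≥0∞) = E.likelihoodMeasure μ a y Set.univ :=
  ENNReal.coe_toNNReal (ne_top_of_le_ne_top ENNReal.coe_ne_top (V.likelihoodMeasure_univ_le hy μ a))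

theorem Envelope.evidence_le (V : E.Envelope) {y : Y} (hy : y ∈ V.G)
    (μ : ProbabilityMeasure Θ) (a : A) : E.evidence μ a y ≤ V.M y * V.r y := by
  rw [← ENNReal.coe_le_coe, V.coe_evidence hy]
  exact V.likelihoodMeasure_univ_le hy μ a

theorem Envelope.predictive_eq (V : E.Envelope) (μ : ProbabilityMeasure Θ) (a : A) :
    E.predictive μ a = E.ν.withDensity fun y => (E.evidence μ a y : ℝ≥0∞) := by
  have := E.sigmaFinite
  have hm : Measurable fun θ => E.Qm (θ, a) :=
    E.Qm.measurable.comp (measurable_id.prodMk measurable_const)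
  ext s hs
  rw [predictive, Measure.bind_apply hs hm.aemeasurable, withDensity_apply _ hs]
  simp_rw [Qm_eq, withDensity_apply _ hs]
  rw [lintegral_lintegral_swap]
  · refine lintegral_congr_ae ?_
    filter_upwards [ae_restrict_of_ae V.ae_mem] with y hy
    rw [V.coe_evidence hy, likelihoodMeasure_univ]
  · have : Measurable fun p : Θ × Y => (E.qm p.1 a p.2 : ℝ≥0∞) :=
      measurable_coe_nnreal_ennreal.comp (E.measurable_qm.comp
        (measurable_fst.prodMk (measurable_const.prodMk measurable_snd)))
    exact this.aemeasurable

theorem Envelope.continuous_evidence (V : E.Envelope) {y : Y} (hy : y ∈ V.G) :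
    Continuous fun p : ProbabilityMeasure Θ × A => (E.evidence p.1 p.2 y : ℝ) := by
  simp_rw [evidence_eq_integral]
  exact ProbabilityMeasure.continuous_integral_prod (f := fun θ a => (E.qm θ a y : ℝ))
    (NNReal.continuous_coe.comp (V.continuous_qm y hy))

/-- Integrals with respect to the posterior. -/
theorem Envelope.evidence_mul_integral_bayes (V : E.Envelope) {y : Y} (hy : y ∈ V.G)
    (μ : ProbabilityMeasure Θ) (a : A) (f : Θ → ℝ) :
    E.evidence μ a y * ∫ θ, f θ ∂(E.bayes μ a y : Measure Θ) =
      ∫ θ, E.qm θ a y * f θ ∂(μ : Measure Θ) := by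
  by_cases h0 : E.evidence μ a y = 0
  · have h1 : E.likelihoodMeasure μ a y Set.univ = 0 := by
      rw [← V.coe_evidence hy, h0]; simp
    rw [likelihoodMeasure_univ, lintegral_eq_zero_iff
      (E.measurable_qm_left a y).coe_nnreal_ennreal] at h1
    rw [h0, NNReal.coe_zero, zero_mul, eq_comm]
    refine integral_eq_zero_of_ae ?_
    filter_upwards [h1] with θ hθ
    have : E.qm θ a y = 0 := by simpa using hθ
    simp [this]
  · have h1 : E.likelihoodMeasure μ a y Set.univ ≠ 0 := by
      rw [← V.coe_evidence hy]; simpa using h0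
    have h2 : E.likelihoodMeasure μ a y Set.univ ≠ ∞ := by
      rw [← V.coe_evidence hy]; simp
    have h3 : (E.bayes μ a y : Measure Θ) =
        (E.likelihoodMeasure μ a y Set.univ)⁻¹ • E.likelihoodMeasure μ a y := by
      simp [bayes, posterior, h1, h2]
    rw [h3, integral_smul_measure, ← V.coe_evidence hy, likelihoodMeasure,
      integral_withDensity_eq_integral_smul (E.measurable_qm_left a y)]
    simp only [ENNReal.toReal_inv, ENNReal.coe_toReal, smul_eq_mul, NNReal.smul_def]
    rw [← mul_assoc, mul_inv_cancel₀ (by simpa using h0), one_mul]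

/-- Posterior expectations are quotients of two continuous functions of belief and action. Zero
evidence is excluded: there the posterior is set by convention. -/
theorem Envelope.continuousAt_bayes (V : E.Envelope) {y : Y} (hy : y ∈ V.G)
    {p : ProbabilityMeasure Θ × A} (hp : E.evidence p.1 p.2 y ≠ 0) :
    ContinuousAt (fun p : ProbabilityMeasure Θ × A => E.bayes p.1 p.2 y) p := by
  refine ProbabilityMeasure.tendsto_iff_forall_integral_tendsto.2 fun f => ?_
  have hev := V.continuous_evidence hy
  have hne : ∀ᶠ p' in 𝓝 p, (E.evidence p'.1 p'.2 y : ℝ) ≠ 0 :=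
    hev.continuousAt.eventually_ne (by simpa using hp)
  have key : ∀ p' : ProbabilityMeasure Θ × A, (E.evidence p'.1 p'.2 y : ℝ) ≠ 0 →
      (∫ θ, E.qm θ p'.2 y * f θ ∂(p'.1 : Measure Θ)) / E.evidence p'.1 p'.2 y =
      ∫ θ, f θ ∂(E.bayes p'.1 p'.2 y : Measure Θ) := fun p' h => by
    rw [← V.evidence_mul_integral_bayes hy, mul_div_cancel_left₀ _ h]
  have hc : Continuous fun p : ProbabilityMeasure Θ × A =>
      ∫ θ, E.qm θ p.2 y * f θ ∂(p.1 : Measure Θ) :=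
    ProbabilityMeasure.continuous_integral_prod (f := fun θ a => E.qm θ a y * f θ)
      ((NNReal.continuous_coe.comp (V.continuous_qm y hy)).mul (f.continuous.comp continuous_fst))
  rw [← key p (by simpa using hp)]
  refine Tendsto.congr' ?_ (hc.continuousAt.div hev.continuousAt (by simpa using hp))
  filter_upwards [hne] with p' hp'
  exact key p' hp'

theorem Envelope.dynamicPayoff_eq (V : E.Envelope) (δ : ℝ) (W : ProbabilityMeasure Θ → ℝ)
    (μ : ProbabilityMeasure Θ) (a : A) :
    E.dynamicPayoff δ W μ a =
      ∫ y, E.evidence μ a y * (E.payoff a y + δ * W (E.bayes μ a y)) ∂E.ν := by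
  rw [dynamicPayoff, V.predictive_eq,
    integral_withDensity_eq_integral_smul (E.measurable_evidence_right μ a)]
  rfl

theorem Envelope.integrable_evidence_mul_payoff (V : E.Envelope) (μ : ProbabilityMeasure Θ)
    (a : A) : Integrable (fun y => E.evidence μ a y * E.payoff a y) E.ν := by
  refine V.integrable_h_M_r.mono' ?_ ?_
  · have := E.measurable_evidence_right μ a
    have := E.measurable_payoff a
    fun_prop
  · filter_upwards [V.ae_mem] with y hy
    rw [norm_mul, mul_assoc, mul_comm]
    have := NNReal.coe_le_coe.2 (V.evidence_le hy μ a)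
    gcongr
    · exact V.payoff_le y hy a
    · simpa using this

theorem Envelope.integrable_payoff_predictive (V : E.Envelope) (μ : ProbabilityMeasure Θ) (a : A) :
    Integrable (E.payoff a) (E.predictive μ a) := by
  rw [V.predictive_eq, integrable_withDensity_iff_integrable_smul (E.measurable_evidence_right μ a)]
  exact V.integrable_evidence_mul_payoff μ a

/-- Written as an integral against `ν`, the integrand carries the evidence as a factor. Where the
evidence vanishes Bayes' rule may jump, but its bounded effect is multiplied by a factor tending to
zero. Dominated convergence does the rest. -/
theorem Envelope.continuous_dynamicPayoff (V : E.Envelope) (δ : ℝ)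
    {W : ProbabilityMeasure Θ → ℝ} (hW : Continuous W) :
    Continuous fun p : ProbabilityMeasure Θ × A => E.dynamicPayoff δ W p.1 p.2 := by
  obtain ⟨C, hC⟩ : ∃ C, ∀ μ, |W μ| ≤ C := by
    obtain ⟨C, hC⟩ := isCompact_univ.exists_bound_of_continuousOn hW.continuousOn
    exact ⟨C, fun μ => hC μ trivial⟩
  let := TopologicalSpace.metrizableSpaceMetric (ProbabilityMeasure Θ)
  simp_rw [V.dynamicPayoff_eq]
  refine continuous_of_dominated
    (bound := fun y => V.h y * V.M y * V.r y + |δ| * C * (V.M y * V.r y)) ?_ ?_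
    (V.integrable_h_M_r.add (V.integrable_M_r.const_mul _)) ?_
  · intro p
    have h1 := E.measurable_evidence_right p.1 p.2
    have h2 := E.measurable_payoff p.2
    have h3 := hW.measurable.comp (E.measurable_bayes_right p.1 p.2)
    exact (h1.coe_nnreal_real.mul (h2.add (h3.const_mul δ))).aestronglyMeasurable
  · intro p
    filter_upwards [V.ae_mem] with y hy
    have h1 : (E.evidence p.1 p.2 y : ℝ) ≤ V.M y * V.r y := by
      simpa using NNReal.coe_le_coe.2 (V.evidence_le hy p.1 p.2)
    have h2 : |E.payoff p.2 y + δ * W (E.bayes p.1 p.2 y)| ≤ V.h y + |δ| * C := by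
      refine (abs_add_le _ _).trans (add_le_add (V.payoff_le y hy _) ?_)
      rw [abs_mul]
      exact mul_le_mul_of_nonneg_left (hC _) (abs_nonneg _)
    rw [norm_mul, Real.norm_eq_abs, Real.norm_eq_abs, abs_of_nonneg (NNReal.coe_nonneg _)]
    refine (mul_le_mul h1 h2 (abs_nonneg _) (by positivity)).trans (le_of_eq (by ring))
  · filter_upwards [V.ae_mem] with y hy
    have hev := V.continuous_evidence hy
    have h1 : Continuous fun p : ProbabilityMeasure Θ × A => E.payoff p.2 y :=
      (V.continuous_payoff y hy).comp continuous_snd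
    refine continuous_iff_continuousAt.2 fun p => ?_
    by_cases hp : E.evidence p.1 p.2 y = 0
    · have h2 : Tendsto (fun p : ProbabilityMeasure Θ × A => E.evidence p.1 p.2 y *
          (V.h y + |δ| * C)) (𝓝 p) (𝓝 0) := by
        have := (hev.mul_const (V.h y + |δ| * C)).tendsto p
        simpa only [hp, NNReal.coe_zero, zero_mul] using this
      have h3 : Tendsto (fun p : ProbabilityMeasure Θ × A => E.evidence p.1 p.2 y *
          (E.payoff p.2 y + δ * W (E.bayes p.1 p.2 y))) (𝓝 p) (𝓝 0) := by
        refine squeeze_zero_norm (fun p => ?_) h2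
        rw [norm_mul, Real.norm_eq_abs, Real.norm_eq_abs, abs_of_nonneg (NNReal.coe_nonneg _)]
        refine mul_le_mul_of_nonneg_left ?_ (NNReal.coe_nonneg _)
        refine (abs_add_le _ _).trans (add_le_add (V.payoff_le y hy _) ?_)
        rw [abs_mul]
        exact mul_le_mul_of_nonneg_left (hC _) (abs_nonneg _)
      rw [ContinuousAt]
      simpa [hp] using h3
    · exact hev.continuousAt.mul (h1.continuousAt.add
        (continuousAt_const.mul (hW.continuousAt.comp (V.continuousAt_bayes hy hp))))

end LearningProblem

namespace LearningProblem

variable {A Θ Y : Type*} [MetricSpace A] [CompactSpace A] [MeasurableSpace A] [BorelSpace A]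
  [MetricSpace Θ] [CompactSpace Θ] [MeasurableSpace Θ] [BorelSpace Θ] [MeasurableSpace Y]
  {E : LearningProblem A Θ Y}

/-! ### The value function -/

theorem integrable_comp_bayes (E : LearningProblem A Θ Y) {W : ProbabilityMeasure Θ → ℝ}
    (hW : Measurable W) {C : ℝ} (hC : ∀ μ, |W μ| ≤ C) (μ : ProbabilityMeasure Θ) (a : A) :
    Integrable (fun y => W (E.bayes μ a y)) (E.predictive μ a) := by
  have := E.isProbabilityMeasure_predictive μ a
  exact Integrable.of_bound (hW.comp (E.measurable_bayes_right μ a)).aestronglyMeasurable C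
    (Eventually.of_forall fun y => hC _)

/-- Monotonicity and discounting in one inequality (Blackwell's conditions), used both for the
contraction and for the comparison principle. -/
theorem Envelope.dynamicPayoff_le_add (V : E.Envelope) {δ : ℝ} (hδ : 0 ≤ δ)
    {W₁ W₂ : ProbabilityMeasure Θ → ℝ} (h₁ : Measurable W₁) (h₂ : Measurable W₂)
    (b₁ : ∃ C, ∀ μ, |W₁ μ| ≤ C) (b₂ : ∃ C, ∀ μ, |W₂ μ| ≤ C) {D : ℝ}
    (h : ∀ μ, W₁ μ ≤ W₂ μ + D) (μ : ProbabilityMeasure Θ) (a : A) :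
    E.dynamicPayoff δ W₁ μ a ≤ E.dynamicPayoff δ W₂ μ a + δ * D := by
  obtain ⟨C₁, b₁⟩ := b₁
  obtain ⟨C₂, b₂⟩ := b₂
  have := E.isProbabilityMeasure_predictive μ a
  have i₀ := V.integrable_payoff_predictive μ a
  have i₁ := (E.integrable_comp_bayes h₁ b₁ μ a).const_mul δ
  have i₂ := (E.integrable_comp_bayes h₂ b₂ μ a).const_mul δ
  have : δ * D = ∫ y, δ * D ∂(E.predictive μ a) := by simp
  have i₃ : Integrable (fun y => E.payoff a y + δ * W₂ (E.bayes μ a y)) (E.predictive μ a) :=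
    i₀.add i₂
  rw [dynamicPayoff, dynamicPayoff, this, ← integral_add i₃ (integrable_const _)]
  refine integral_mono (i₀.add i₁) (i₃.add (integrable_const _)) fun y => ?_
  have := mul_le_mul_of_nonneg_left (h (E.bayes μ a y)) hδ
  beta_reduce
  linarith

/-- Comparison principle for subsolutions: each pass through the Bellman equation multiplies the
possible excess of `f` over `W` by `δ`. Asking only for some good action, rather than a maximum,
lets it apply to fixed policies as well. -/
theorem Envelope.le_valueFunction (V : E.Envelope) {δ : ℝ} (hδ : δ ∈ Set.Ioo (0 : ℝ) 1)
    {W f : ProbabilityMeasure Θ → ℝ} (hW : E.IsValueFunction δ W) (hf : Measurable f)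
    (bf : ∃ C, ∀ μ, |f μ| ≤ C) (hfd : ∀ μ, ∃ a, f μ ≤ E.dynamicPayoff δ f μ a)
    (μ : ProbabilityMeasure Θ) : f μ ≤ W μ := by
  obtain ⟨C₁, hC₁⟩ := id bf
  obtain ⟨C₂, hC₂⟩ := hW.bounded
  have key : ∀ n : ℕ, ∀ μ, f μ ≤ W μ + δ ^ n * (C₁ + C₂) := by
    intro n
    induction n with
    | zero =>
      intro μ
      have h1 := abs_le.1 (hC₁ μ)
      have h2 := abs_le.1 (hC₂ μ)
      simp only [pow_zero, one_mul]
      linarith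
    | succ n ih =>
      intro μ
      obtain ⟨a, ha⟩ := hfd μ
      have h1 := V.dynamicPayoff_le_add hδ.1.le hf hW.measurable bf hW.bounded ih μ a
      have h2 : E.dynamicPayoff δ W μ a ≤ W μ := (hW.bellman μ).2 ⟨a, rfl⟩
      rw [pow_succ']
      linarith
  have hlim : Tendsto (fun n : ℕ => W μ + δ ^ n * (C₁ + C₂)) atTop (𝓝 (W μ)) := by
    simpa using ((tendsto_pow_atTop_nhds_zero_of_lt_one hδ.1.le hδ.2).mul_const (C₁ + C₂)).const_add
      (W μ)
  exact ge_of_tendsto' hlim fun n => key n μ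

theorem Envelope.valueFunction_unique (V : E.Envelope) {δ : ℝ} (hδ : δ ∈ Set.Ioo (0 : ℝ) 1)
    {W₁ W₂ : ProbabilityMeasure Θ → ℝ} (h₁ : E.IsValueFunction δ W₁)
    (h₂ : E.IsValueFunction δ W₂) : W₁ = W₂ := by
  have key : ∀ {W₁ W₂ : ProbabilityMeasure Θ → ℝ}, E.IsValueFunction δ W₁ →
      E.IsValueFunction δ W₂ → ∀ μ, W₁ μ ≤ W₂ μ := fun h₁ h₂ μ =>
    V.le_valueFunction hδ h₂ h₁.measurable h₁.bounded
      (fun μ => let ⟨a, ha⟩ := (h₁.bellman μ).1; ⟨a, ha.ge⟩) μ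
  exact funext fun μ => le_antisymm (key h₁ h₂ μ) (key h₂ h₁ μ)

/-- The Bellman operator on continuous functions. -/
noncomputable def Envelope.bellman (V : E.Envelope) (δ : ℝ) (W : C(ProbabilityMeasure Θ, ℝ)) :
    C(ProbabilityMeasure Θ, ℝ) :=
  ⟨fun μ => sSup (E.dynamicPayoff δ W μ '' Set.univ),
    isCompact_univ.continuous_sSup (V.continuous_dynamicPayoff δ W.continuous)⟩

theorem Envelope.isGreatest_bellman [Nonempty A] (V : E.Envelope) (δ : ℝ)
    (W : C(ProbabilityMeasure Θ, ℝ)) (μ : ProbabilityMeasure Θ) :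
    IsGreatest (Set.range (E.dynamicPayoff δ W μ)) (V.bellman δ W μ) := by
  have hc : Continuous (E.dynamicPayoff δ W μ) :=
    (V.continuous_dynamicPayoff δ W.continuous).comp
      (g := fun p : ProbabilityMeasure Θ × A => E.dynamicPayoff δ W p.1 p.2) (f := fun a => (μ, a))
      (by fun_prop)
  have := (isCompact_range hc).isGreatest_sSup (Set.range_nonempty _)
  simpa [bellman] using this

theorem ContinuousMap.exists_bound {X : Type*} [TopologicalSpace X] [CompactSpace X]
    (W : C(X, ℝ)) : ∃ C, ∀ μ, |W μ| ≤ C :=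
  ⟨‖W‖, fun μ => ContinuousMap.norm_coe_le_norm W μ⟩

theorem Envelope.contractingWith_bellman [Nonempty A] (V : E.Envelope) {δ : ℝ}
    (hδ : δ ∈ Set.Ioo (0 : ℝ) 1) : ContractingWith (Real.toNNReal δ) (V.bellman δ) := by
  refine ⟨by simpa using hδ.2, LipschitzWith.of_dist_le_mul fun W₁ W₂ => ?_⟩
  rw [Real.coe_toNNReal _ hδ.1.le]
  have key : ∀ W₁ W₂ : C(ProbabilityMeasure Θ, ℝ), ∀ μ,
      V.bellman δ W₁ μ ≤ V.bellman δ W₂ μ + δ * dist W₁ W₂ := by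
    intro W₁ W₂ μ
    obtain ⟨a, ha⟩ := (V.isGreatest_bellman δ W₁ μ).1
    have h2 : E.dynamicPayoff δ W₂ μ a ≤ V.bellman δ W₂ μ := (V.isGreatest_bellman δ W₂ μ).2 ⟨a, rfl⟩
    have h3 := V.dynamicPayoff_le_add hδ.1.le W₁.continuous.measurable W₂.continuous.measurable
      (ContinuousMap.exists_bound W₁) (ContinuousMap.exists_bound W₂) (D := dist W₁ W₂)
      (fun μ => by
        have := (abs_le.1 ((Real.dist_eq _ _).symm.trans_le
          (ContinuousMap.dist_apply_le_dist (f := W₁) (g := W₂) μ))).2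
        linarith) μ a
    rw [← ha]
    linarith
  refine (ContinuousMap.dist_le (by have := hδ.1; positivity)).2 fun μ => ?_
  rw [Real.dist_eq, abs_le]
  have h1 := key W₁ W₂ μ
  have h2 := key W₂ W₁ μ
  rw [dist_comm W₂ W₁] at h2
  constructor <;> linarith

/-- Banach's fixed point theorem in the complete space of continuous functions on the compact space
of beliefs. -/
theorem Envelope.exists_continuous_valueFunction [Nonempty A] (V : E.Envelope) {δ : ℝ}
    (hδ : δ ∈ Set.Ioo (0 : ℝ) 1) :
    ∃ W : ProbabilityMeasure Θ → ℝ, Continuous W ∧ E.IsValueFunction δ W := by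
  have hT := V.contractingWith_bellman hδ
  set W := ContractingWith.fixedPoint _ hT
  have hW : V.bellman δ W = W := hT.fixedPoint_isFixedPt
  refine ⟨W, W.continuous, W.continuous.measurable, ContinuousMap.exists_bound W, fun μ => ?_⟩
  have := V.isGreatest_bellman δ W μ
  rwa [hW] at this

/-! ### Myopic and dynamic optimality -/

/-- Justifies the exchanges of integrals over parameters and consequences: `p` is the payoff in one
use and the constant one in the other. -/
theorem Envelope.integrable_prod (V : E.Envelope) (μ : ProbabilityMeasure Θ) (a : A) {f : Θ → ℝ}
    (hf : Measurable f) {C : ℝ} (hC : ∀ θ, |f θ| ≤ C) {p : Y → ℝ} (hp : Measurable p) {b : Y → ℝ}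
    (hpb : ∀ y ∈ V.G, |p y| ≤ b y) (hb : Integrable (fun y => b y * (V.M y * V.r y)) E.ν) :
    Integrable (fun z : Θ × Y => E.qm z.1 a z.2 * f z.1 * p z.2) ((μ : Measure Θ).prod E.ν) := by
  have := E.sigmaFinite
  have hm : Measurable fun z : Θ × Y => E.qm z.1 a z.2 :=
    E.measurable_qm.comp (measurable_fst.prodMk (measurable_const.prodMk measurable_snd))
  refine ((hb.comp_snd (μ : Measure Θ)).const_mul C).mono' ?_ ?_
  · exact ((hm.coe_nnreal_real.mul (hf.comp measurable_fst)).mul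
      (hp.comp measurable_snd)).aestronglyMeasurable
  · filter_upwards [Measure.quasiMeasurePreserving_snd.ae V.ae_mem] with z hz
    have h1 : (E.qm z.1 a z.2 : ℝ) ≤ V.M z.2 * V.r z.2 := by
      simpa using NNReal.coe_le_coe.2 (V.qm_le_M_r hz z.1 a)
    have h2 := hpb _ hz
    have h3 := hC z.1
    rw [norm_mul, norm_mul, Real.norm_eq_abs, Real.norm_eq_abs, Real.norm_eq_abs,
      abs_of_nonneg (NNReal.coe_nonneg _)]
    calc (E.qm z.1 a z.2 : ℝ) * |f z.1| * |p z.2|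
        ≤ (V.M z.2 * V.r z.2) * C * b z.2 := by
          have : 0 ≤ C := (abs_nonneg _).trans h3
          gcongr
      _ = _ := by ring

theorem expectedPayoff_eq (E : LearningProblem A Θ Y) (a : A) (θ : Θ) :
    E.expectedPayoff a θ = ∫ y, E.qm θ a y * E.payoff a y ∂E.ν := by
  rw [expectedPayoff, E.Qm_eq,
    integral_withDensity_eq_integral_smul (E.measurable_qm_right θ a)]
  rfl

theorem measurable_expectedPayoff (E : LearningProblem A Θ Y) (a : A) :
    Measurable (E.expectedPayoff a) := by
  have : StronglyMeasurable fun z : Θ × Y => E.payoff a z.2 :=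
    ((E.measurable_payoff a).comp measurable_snd).stronglyMeasurable
  have h := this.integral_kernel_prod_right' (κ := E.Qm.comap (fun θ : Θ => (θ, a)) (by fun_prop))
  exact h.measurable

theorem Envelope.abs_expectedPayoff_le (V : E.Envelope) (a : A) (θ : Θ) :
    |E.expectedPayoff a θ| ≤ ∫ y, (V.h y * V.M y * V.r y : ℝ) ∂E.ν := by
  rw [expectedPayoff_eq, ← Real.norm_eq_abs]
  refine norm_integral_le_of_norm_le V.integrable_h_M_r ?_
  filter_upwards [V.ae_mem] with y hy
  have h1 : (E.qm θ a y : ℝ) ≤ V.M y * V.r y := by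
    simpa using NNReal.coe_le_coe.2 (V.qm_le_M_r hy θ a)
  have h2 := V.payoff_le y hy a
  rw [norm_mul, Real.norm_eq_abs, Real.norm_eq_abs, abs_of_nonneg (NNReal.coe_nonneg _)]
  calc (E.qm θ a y : ℝ) * |E.payoff a y| ≤ (V.M y * V.r y) * V.h y := by gcongr
    _ = _ := by ring

theorem Envelope.integral_predictive_payoff (V : E.Envelope) (μ : ProbabilityMeasure Θ) (a : A) :
    ∫ y, E.payoff a y ∂(E.predictive μ a) = ∫ θ, E.expectedPayoff a θ ∂(μ : Measure Θ) := by
  have := E.sigmaFinite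
  rw [V.predictive_eq, integral_withDensity_eq_integral_smul (E.measurable_evidence_right μ a)]
  simp_rw [expectedPayoff_eq, NNReal.smul_def, evidence_eq_integral, smul_eq_mul,
    ← integral_mul_const]
  rw [integral_integral_swap]
  have h := V.integrable_prod μ a (f := fun _ => 1) measurable_const (C := 1) (by simp)
    (E.measurable_payoff a) (fun y hy => V.payoff_le y hy a) (by
      simpa only [mul_assoc] using V.integrable_h_M_r)
  simpa [Function.uncurry_def, Function.comp_def] using h.swap

/-- Posteriors average to the prior. -/
theorem Envelope.integral_predictive_bayes (V : E.Envelope) (μ : ProbabilityMeasure Θ) (a : A)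
    {f : Θ → ℝ} (hf : Measurable f) {C : ℝ} (hC : ∀ θ, |f θ| ≤ C) :
    ∫ y, ∫ θ, f θ ∂(E.bayes μ a y : Measure Θ) ∂(E.predictive μ a) =
      ∫ θ, f θ ∂(μ : Measure Θ) := by
  have := E.sigmaFinite
  rw [V.predictive_eq, integral_withDensity_eq_integral_smul (E.measurable_evidence_right μ a)]
  have h1 : ∫ y, E.evidence μ a y • ∫ θ, f θ ∂(E.bayes μ a y : Measure Θ) ∂E.ν =
      ∫ y, ∫ θ, E.qm θ a y * f θ ∂(μ : Measure Θ) ∂E.ν := by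
    refine integral_congr_ae ?_
    filter_upwards [V.ae_mem] with y hy
    exact V.evidence_mul_integral_bayes hy μ a f
  rw [h1, integral_integral_swap]
  · refine integral_congr_ae (Eventually.of_forall fun θ => ?_)
    have h2 : ∫ y, (E.qm θ a y : ℝ) ∂E.ν = 1 := by
      have h3 : ∫ y, (1 : ℝ) ∂(E.Qm (θ, a)) = 1 := by simp
      rw [E.Qm_eq, integral_withDensity_eq_integral_smul (E.measurable_qm_right θ a)] at h3
      simpa [NNReal.smul_def] using h3
    simp only [integral_mul_const, h2, one_mul]
  · have h := V.integrable_prod μ a hf hC (p := fun _ => 1) measurable_const (b := fun _ => 1)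
      (by simp) (by simpa using V.integrable_M_r)
    simpa [Function.uncurry_def, Function.comp_def] using h.swap

theorem measurable_integral_probabilityMeasure {X : Type*} [MeasurableSpace X] {f : X → ℝ}
    (hf : Measurable f) : Measurable fun μ : ProbabilityMeasure X => ∫ x, f x ∂(μ : Measure X) := by
  let κ : Kernel (ProbabilityMeasure X) X := ⟨fun μ => (μ : Measure X), measurable_subtype_coe⟩
  have : IsMarkovKernel κ := ⟨fun μ => inferInstanceAs (IsProbabilityMeasure (μ : Measure X))⟩
  have h : StronglyMeasurable fun z : ProbabilityMeasure X × X => f z.2 :=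
    (hf.comp measurable_snd).stronglyMeasurable
  exact (h.integral_kernel_prod_right' (κ := κ)).measurable

/-- The value of repeating an action forever is a lower bound of the value function. -/
theorem Envelope.expectedPayoff_le_valueFunction (V : E.Envelope) {δ : ℝ}
    (hδ : δ ∈ Set.Ioo (0 : ℝ) 1) {W : ProbabilityMeasure Θ → ℝ} (hW : E.IsValueFunction δ W)
    (μ : ProbabilityMeasure Θ) (a : A) :
    ∫ θ, E.expectedPayoff a θ ∂(μ : Measure Θ) ≤ (1 - δ) * W μ := by
  have h1δ : 0 < 1 - δ := by linarith [hδ.2]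
  -- `f` is the present value of repeating `a`. Posteriors average to the prior and `f` is linear in
  -- the belief, so `f` equals its own dynamic payoff at `a` and is a subsolution.
  set f : ProbabilityMeasure Θ → ℝ := fun μ =>
    (1 - δ)⁻¹ * ∫ θ, E.expectedPayoff a θ ∂(μ : Measure Θ) with hf
  have hfm : Measurable f :=
    (measurable_integral_probabilityMeasure (E.measurable_expectedPayoff a)).const_mul _
  have hfb : ∀ μ, |f μ| ≤ (1 - δ)⁻¹ * ∫ y, (V.h y * V.M y * V.r y : ℝ) ∂E.ν := fun μ => by
    rw [abs_mul, abs_of_pos (inv_pos.2 h1δ)]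
    refine mul_le_mul_of_nonneg_left ?_ (inv_pos.2 h1δ).le
    simpa using norm_integral_le_of_norm_le_const (μ := (μ : Measure Θ)) (f := E.expectedPayoff a)
      (Eventually.of_forall fun θ => V.abs_expectedPayoff_le a θ)
  have h := V.le_valueFunction hδ hW hfm ⟨_, hfb⟩ (fun μ => ⟨a, ?_⟩) μ
  · rwa [hf, inv_mul_le_iff₀ h1δ] at h
  · rw [dynamicPayoff, integral_add (V.integrable_payoff_predictive μ a)
      ((E.integrable_comp_bayes hfm hfb μ a).const_mul δ), V.integral_predictive_payoff,
      integral_const_mul, hf, integral_const_mul,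
      V.integral_predictive_bayes μ a (E.measurable_expectedPayoff a) (V.abs_expectedPayoff_le a)]
    refine le_of_eq ?_
    field_simp
    ring

/-- Bayesian updating is trivial after an uninformative action. -/
theorem bayes_eq_self (E : LearningProblem A Θ Y) {μ : ProbabilityMeasure Θ} {a : A} {θ₀ : Θ}
    (h : ∀ᵐ θ ∂(μ : Measure Θ), E.Qm (θ, a) = E.Qm (θ₀, a)) :
    ∀ᵐ y ∂E.ν, E.bayes μ a y = μ := by
  have := E.sigmaFinite
  have h1 : ∀ᵐ θ ∂(μ : Measure Θ), ∀ᵐ y ∂E.ν, E.qm θ a y = E.qm θ₀ a y := by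
    filter_upwards [h] with θ hθ
    rw [E.Qm_eq, E.Qm_eq, withDensity_eq_iff_of_sigmaFinite
      (E.measurable_qm_right θ a).coe_nnreal_ennreal.aemeasurable
      (E.measurable_qm_right θ₀ a).coe_nnreal_ennreal.aemeasurable] at hθ
    filter_upwards [hθ] with y hy
    simpa using hy
  have hm : MeasurableSet {z : Θ × Y | E.qm z.1 a z.2 = E.qm θ₀ a z.2} :=
    measurableSet_eq_fun
      (E.measurable_qm.comp (measurable_fst.prodMk (measurable_const.prodMk measurable_snd)))
      ((E.measurable_qm_right θ₀ a).comp measurable_snd)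
  -- The null set of consequences depends on `θ`; Fubini exchanges the two quantifiers, making the
  -- likelihood constant in `θ` for almost every `y`.
  have h2 := (Measure.ae_ae_comm hm).1 h1
  filter_upwards [h2] with y hy
  have h3 : E.likelihoodMeasure μ a y = (E.qm θ₀ a y : ℝ≥0∞) • (μ : Measure Θ) := by
    rw [likelihoodMeasure, ← withDensity_const]
    refine withDensity_congr_ae ?_
    filter_upwards [hy] with θ hθ
    simpa using hθ
  refine Subtype.ext ?_
  change E.posterior μ a y = _
  rw [posterior, h3]
  split_ifs with h0
  · simp only [Measure.smul_apply, measure_univ, smul_eq_mul, mul_one] at h0 ⊢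
    rw [smul_smul, ENNReal.inv_mul_cancel h0.1 h0.2, one_smul]
    rfl
  · rfl

/-- An action that leaves the belief unchanged has no informational value: its continuation value is
`δ W(μ)`. Optimality gives `(1 - δ) W(μ) ≤ U(a, μ)`, while the left side dominates the payoff of
every repeated action. -/
theorem Envelope.mem_myopicOptimal (V : E.Envelope) {δ : ℝ} (hδ : δ ∈ Set.Ioo (0 : ℝ) 1)
    {W : ProbabilityMeasure Θ → ℝ} (hW : E.IsValueFunction δ W) {μ : ProbabilityMeasure Θ} {a : A}
    (ha : a ∈ E.dynamicOptimal δ W μ) {θ₀ : Θ}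
    (h : ∀ᵐ θ ∂(μ : Measure Θ), E.Qm (θ, a) = E.Qm (θ₀, a)) : a ∈ E.myopicOptimal μ := by
  intro a'
  have hp := E.isProbabilityMeasure_predictive μ a
  refine (V.expectedPayoff_le_valueFunction hδ hW μ a').trans ?_
  have h1 : W μ ≤ E.dynamicPayoff δ W μ a := by
    obtain ⟨a₀, h0⟩ := (hW.bellman μ).1
    exact h0 ▸ ha a₀
  have h2 : E.dynamicPayoff δ W μ a = ∫ θ, E.expectedPayoff a θ ∂(μ : Measure Θ) + δ * W μ := by
    obtain ⟨C, hC⟩ := hW.bounded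
    rw [dynamicPayoff, integral_add (V.integrable_payoff_predictive μ a)
      ((E.integrable_comp_bayes hW.measurable hC μ a).const_mul δ), V.integral_predictive_payoff]
    congr 1
    have h3 : ∀ᵐ y ∂(E.predictive μ a), δ * W (E.bayes μ a y) = δ * W μ := by
      rw [V.predictive_eq]
      refine (withDensity_absolutelyContinuous _ _).ae_le ?_
      filter_upwards [E.bayes_eq_self h] with y hy
      rw [hy]
    rw [integral_congr_ae h3]
    simp
  linarith

end LearningProblem

/-! ### A strong law of large numbers for orthogonal random variables -/

section StrongLaw

variable {Ω : Type*} [MeasurableSpace Ω] {P : Measure Ω}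

/-- The sum of the functions has finite integral, so the series converges almost everywhere and its
terms vanish. -/
theorem ae_tendsto_zero_of_integral_le {f : ℕ → Ω → ℝ} (hf : ∀ k, Integrable (f k) P)
    (h0 : ∀ k ω, 0 ≤ f k ω) {c : ℕ → ℝ} (hc : Summable c) (hfc : ∀ k, ∫ ω, f k ω ∂P ≤ c k) :
    ∀ᵐ ω ∂P, Tendsto (fun k => f k ω) atTop (𝓝 0) := by
  have hm : ∀ k, AEMeasurable (fun ω => ENNReal.ofReal (f k ω)) P := fun k =>
    (hf k).aestronglyMeasurable.aemeasurable.ennreal_ofReal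
  have h1 : ∫⁻ ω, ∑' k, ENNReal.ofReal (f k ω) ∂P ≠ ∞ := by
    rw [lintegral_tsum hm]
    refine ne_top_of_le_ne_top hc.tsum_ofReal_ne_top (ENNReal.tsum_le_tsum fun k => ?_)
    rw [← ofReal_integral_eq_lintegral_ofReal (hf k) (Eventually.of_forall (h0 k))]
    exact ENNReal.ofReal_le_ofReal (hfc k)
  filter_upwards [ae_lt_top' (AEMeasurable.tsum hm) h1] with ω hω
  have h2 := ENNReal.tendsto_atTop_zero_of_tsum_ne_top hω.ne
  have h3 := (ENNReal.tendsto_toReal ENNReal.zero_ne_top).comp h2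
  refine h3.congr fun k => ?_
  simp [ENNReal.toReal_ofReal (h0 k ω)]

variable {X : ℕ → Ω → ℝ} {C : ℝ}

theorem integral_sq_sum_le_of_orthogonal (hX : ∀ i, MemLp (X i) 2 P)
    (hC : ∀ i, ∫ ω, X i ω ^ 2 ∂P ≤ C) (ho : ∀ i j, i < j → ∫ ω, X i ω * X j ω ∂P = 0)
    (s : Finset ℕ) : ∫ ω, (∑ i ∈ s, X i ω) ^ 2 ∂P ≤ s.card * C := by
  have hi : ∀ i j, Integrable (fun ω => X i ω * X j ω) P := fun i j => (hX i).integrable_mul (hX j)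
  have h1 : ∫ ω, (∑ i ∈ s, X i ω) ^ 2 ∂P = ∑ i ∈ s, ∑ j ∈ s, ∫ ω, X i ω * X j ω ∂P := by
    simp_rw [sq, Finset.sum_mul_sum]
    rw [integral_finsetSum _ fun i _ => integrable_finsetSum _ fun j _ => hi i j]
    exact Finset.sum_congr rfl fun i _ => integral_finsetSum _ fun j _ => hi i j
  rw [h1, ← nsmul_eq_mul, ← Finset.sum_const]
  refine Finset.sum_le_sum fun i hi => ?_
  rw [Finset.sum_eq_single_of_mem i hi]
  · simpa [sq] using hC i
  · intro j _ hj
    rcases lt_or_gt_of_ne hj with h | h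
    · simpa [mul_comm] using ho j i h
    · exact ho i j h

/-- Absolute values destroy orthogonality, so only Cauchy–Schwarz remains. The lost factor `s.card`
is affordable on the short blocks between consecutive squares. -/
theorem integral_sq_sum_abs_le (hX : ∀ i, MemLp (X i) 2 P)
    (hC : ∀ i, ∫ ω, X i ω ^ 2 ∂P ≤ C) (s : Finset ℕ) :
    ∫ ω, (∑ i ∈ s, |X i ω|) ^ 2 ∂P ≤ s.card * (s.card * C) := by
  have hm : MemLp (fun ω => ∑ i ∈ s, |X i ω|) 2 P := memLp_finsetSum s fun i _ => (hX i).norm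
  have hi : Integrable (fun ω => (s.card : ℝ) * ∑ i ∈ s, X i ω ^ 2) P :=
    (integrable_finsetSum _ fun i _ => (hX i).integrable_sq).const_mul _
  calc ∫ ω, (∑ i ∈ s, |X i ω|) ^ 2 ∂P ≤ ∫ ω, (s.card : ℝ) * ∑ i ∈ s, X i ω ^ 2 ∂P := by
        refine integral_mono hm.integrable_sq hi fun ω => ?_
        simpa using sq_sum_le_card_mul_sum_sq (s := s) (f := fun i => |X i ω|)
    _ = s.card * ∑ i ∈ s, ∫ ω, X i ω ^ 2 ∂P := by
        rw [integral_const_mul, integral_finsetSum _ fun i _ => (hX i).integrable_sq]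
    _ ≤ s.card * (s.card * C) := by
        gcongr
        rw [← nsmul_eq_mul, ← Finset.sum_const]
        exact Finset.sum_le_sum fun i _ => hC i

/-- Averages of orthogonal random variables with bounded second moments converge to zero. -/
theorem ae_tendsto_average_zero_of_orthogonal (hX : ∀ i, MemLp (X i) 2 P)
    (hC : ∀ i, ∫ ω, X i ω ^ 2 ∂P ≤ C) (ho : ∀ i j, i < j → ∫ ω, X i ω * X j ω ∂P = 0) :
    ∀ᵐ ω ∂P, Tendsto (fun n : ℕ => (∑ i ∈ Finset.range n, X i ω) / n) atTop (𝓝 0) := by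
  have hC0 : 0 ≤ C := (integral_nonneg fun ω => sq_nonneg (X 0 ω)).trans (hC 0)
  -- The constant 9 covers both estimates. The sum up to `k²` has second moment at most `C k²`; the
  -- block up to `(k + 1)²` has `2k + 1 ≤ 3k` terms, hence second moment at most `9 C k²`. Both are
  -- then divided by `k⁴`.
  have hsum : Summable fun k : ℕ => 9 * C * (1 / (k : ℝ) ^ 2) :=
    (Real.summable_one_div_nat_pow.2 one_lt_two).mul_left _
  have hmA : ∀ k : ℕ, MemLp (fun ω => (∑ i ∈ Finset.range (k ^ 2), X i ω) / (k : ℝ) ^ 2) 2 P := by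
    intro k
    have h : MemLp (fun ω => ∑ i ∈ Finset.range (k ^ 2), X i ω) 2 P := memLp_finsetSum _ fun i _ => hX i
    simpa only [div_eq_mul_inv] using h.mul_const ((k : ℝ) ^ 2)⁻¹
  have hmB : ∀ k : ℕ, MemLp (fun ω => (∑ i ∈ Finset.Ico (k ^ 2) ((k + 1) ^ 2), |X i ω|) /
      (k : ℝ) ^ 2) 2 P := by
    intro k
    have h : MemLp (fun ω => ∑ i ∈ Finset.Ico (k ^ 2) ((k + 1) ^ 2), |X i ω|) 2 P :=
      memLp_finsetSum _ fun i _ => (hX i).norm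
    simpa only [div_eq_mul_inv] using h.mul_const ((k : ℝ) ^ 2)⁻¹
  have hA := ae_tendsto_zero_of_integral_le (P := P)
    (f := fun k ω => ((∑ i ∈ Finset.range (k ^ 2), X i ω) / (k : ℝ) ^ 2) ^ 2)
    (fun k => (hmA k).integrable_sq)
    (fun k ω => sq_nonneg _) hsum (fun k => by
      simp_rw [div_pow, integral_div]
      have h := integral_sq_sum_le_of_orthogonal hX hC ho (Finset.range (k ^ 2))
      rcases Nat.eq_zero_or_pos k with rfl | hk
      · simp
      have hk' : (0 : ℝ) < k := by exact_mod_cast hk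
      rw [div_le_iff₀ (by positivity)]
      refine h.trans ?_
      rw [Finset.card_range]
      push_cast
      field_simp
      nlinarith)
  have hB := ae_tendsto_zero_of_integral_le (P := P)
    (f := fun k ω => ((∑ i ∈ Finset.Ico (k ^ 2) ((k + 1) ^ 2), |X i ω|) / (k : ℝ) ^ 2) ^ 2)
    (fun k => (hmB k).integrable_sq)
    (fun k ω => sq_nonneg _) hsum (fun k => by
      simp_rw [div_pow, integral_div]
      have h := integral_sq_sum_abs_le hX hC (Finset.Ico (k ^ 2) ((k + 1) ^ 2))
      rcases Nat.eq_zero_or_pos k with rfl | hk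
      · simp
      have hk' : (1 : ℝ) ≤ k := by exact_mod_cast hk
      have hcard : ((Finset.Ico (k ^ 2) ((k + 1) ^ 2)).card : ℝ) = 2 * k + 1 := by
        rw [Nat.card_Ico, show (k + 1) ^ 2 - k ^ 2 = 2 * k + 1 by
          rw [add_sq, add_assoc, Nat.add_sub_cancel_left]; ring]
        push_cast
        ring
      rw [hcard] at h
      rw [div_le_iff₀ (by positivity)]
      refine h.trans ?_
      have : (9 * C * (1 / (k : ℝ) ^ 2)) * ((k : ℝ) ^ 2) ^ 2 = 9 * C * (k : ℝ) ^ 2 := by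
        field_simp
      rw [this]
      nlinarith [mul_nonneg hC0 (sub_nonneg.2 hk'),
        mul_nonneg (mul_nonneg hC0 (sub_nonneg.2 hk')) (by positivity : (0 : ℝ) ≤ k)])
  filter_upwards [hA, hB] with ω hAω hBω
  have h1 := hAω.sqrt
  have h2 := hBω.sqrt
  simp_rw [Real.sqrt_sq_eq_abs, Real.sqrt_zero] at h1 h2
  have hs : Tendsto Nat.sqrt atTop atTop := by
    refine tendsto_atTop.2 fun b => ?_
    filter_upwards [eventually_ge_atTop (b * b)] with n hn
    exact Nat.le_sqrt.2 hn
  have h3 := (h1.add h2).comp hs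
  rw [add_zero] at h3
  -- With `k` the integer square root of `n`, the partial sum is at most the sum up to `k²` plus the
  -- absolute block sum, and `n ≥ k²`.
  refine squeeze_zero_norm' ?_ h3
  filter_upwards [eventually_ge_atTop 1] with n hn
  have hk : (1 : ℝ) ≤ Nat.sqrt n := by exact_mod_cast Nat.le_sqrt.2 (by simpa using hn)
  have hkn : ((Nat.sqrt n : ℝ)) ^ 2 ≤ n := by exact_mod_cast Nat.sqrt_le' n
  have hn2 : n ≤ (Nat.sqrt n + 1) ^ 2 := (Nat.lt_succ_sqrt' n).le
  set k := Nat.sqrt n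
  have hkn' : k ^ 2 ≤ n := by exact_mod_cast hkn
  have h4 : |∑ i ∈ Finset.range n, X i ω| ≤ |∑ i ∈ Finset.range (k ^ 2), X i ω| +
      ∑ i ∈ Finset.Ico (k ^ 2) ((k + 1) ^ 2), |X i ω| := by
    rw [← Finset.sum_range_add_sum_Ico _ hkn']
    refine (abs_add_le _ _).trans (add_le_add le_rfl ?_)
    refine (Finset.abs_sum_le_sum_abs _ _).trans ?_
    exact Finset.sum_le_sum_of_subset_of_nonneg (Finset.Ico_subset_Ico le_rfl hn2)
      fun _ _ _ => abs_nonneg _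
  simp only [Function.comp_apply, norm_div, Real.norm_eq_abs, abs_div, Nat.abs_cast, abs_pow]
  rw [← add_div]
  exact div_le_div₀ (by positivity) (h4.trans (add_le_add le_rfl (le_abs_self _)))
    (by positivity) hkn

end StrongLaw

theorem ProbabilityTheory.Kernel.map_eval_zero_trajMeasure {X : ℕ → Type*}
    [∀ n, MeasurableSpace (X n)]
    (κ : (n : ℕ) → Kernel ((i : Finset.Iic n) → X i) (X (n + 1))) [∀ n, IsMarkovKernel (κ n)]
    (μ₀ : Measure (X 0)) [IsProbabilityMeasure μ₀] :
    (Kernel.trajMeasure μ₀ κ).map (fun x => x 0) = μ₀ := by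
  have h : (fun x : (n : ℕ) → X n => x 0) =
      (fun y : (i : Finset.Iic 0) → X i => y ⟨0, Finset.mem_Iic.2 le_rfl⟩) ∘
        Preorder.frestrictLe 0 := rfl
  rw [h, ← Measure.map_map (by fun_prop) (by fun_prop), Kernel.trajMeasure,
    Measure.map_comp _ _ (by fun_prop), Kernel.traj_map_frestrictLe, Kernel.partialTraj_self,
    Measure.id_comp]
  exact (Measure.map_map (measurable_pi_apply _) (MeasurableEquiv.measurable _)).trans
    Measure.map_id

theorem memLp_two_of_lintegral_sq_le {Ω : Type*} [MeasurableSpace Ω] {P : Measure Ω} {X : Ω → ℝ}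
    (hX : Measurable X) {C : ℝ≥0} (hC : ∫⁻ ω, ENNReal.ofReal (X ω ^ 2) ∂P ≤ C) : MemLp X 2 P := by
  refine (memLp_two_iff_integrable_sq hX.aestronglyMeasurable).2
    ⟨(hX.pow_const 2).aestronglyMeasurable, ?_⟩
  rw [hasFiniteIntegral_iff_ofReal (Eventually.of_forall fun ω => sq_nonneg _)]
  exact hC.trans_lt ENNReal.coe_lt_top

theorem lintegral_sq_sub_integral_le {Ω : Type*} [MeasurableSpace Ω] {P : Measure Ω}
    [IsProbabilityMeasure P] {X : Ω → ℝ} (hX : MemLp X 2 P) :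
    ∫⁻ ω, ENNReal.ofReal ((X ω - ∫ ω, X ω ∂P) ^ 2) ∂P ≤ ∫⁻ ω, ENNReal.ofReal (X ω ^ 2) ∂P := by
  have hi : Integrable (fun ω => (X ω - ∫ ω, X ω ∂P) ^ 2) P :=
    (hX.sub (memLp_const _)).integrable_sq
  rw [← ofReal_integral_eq_lintegral_ofReal hi
    (Eventually.of_forall fun ω => sq_nonneg _),
    ← ofReal_integral_eq_lintegral_ofReal hX.integrable_sq
    (Eventually.of_forall fun ω => sq_nonneg _)]
  refine ENNReal.ofReal_le_ofReal ?_
  have h := variance_le_expectation_sq (μ := P) hX.aestronglyMeasurable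
  rwa [variance_eq_integral hX.aestronglyMeasurable.aemeasurable] at h

namespace LearningProblem

/-! ### The law of the path -/

section PathLaw

variable {A Θ Y : Type*} [MeasurableSpace A] [MeasurableSpace Θ] [MeasurableSpace Y]
  (E : LearningProblem A Θ Y)

theorem period_apply (ψ : Kernel (ProbabilityMeasure Θ) A) [IsMarkovKernel ψ]
    (μ : ProbabilityMeasure Θ) :
    E.period ψ μ = (ψ μ ⊗ₘ E.Q).map fun p => (μ, p) := by
  rw [period, Kernel.prod_apply, Kernel.id_apply, Measure.dirac_prod,
    Kernel.compProd_apply_eq_compProd_sectR, Kernel.sectR_prodMkLeft]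

theorem ae_period_iff (ψ : Kernel (ProbabilityMeasure Θ) A) [IsMarkovKernel ψ]
    (μ : ProbabilityMeasure Θ) {p : ProbabilityMeasure Θ × A × Y → Prop}
    (hp : MeasurableSet {z | p z}) :
    (∀ᵐ z ∂(E.period ψ μ), p z) ↔ ∀ᵐ a ∂(ψ μ), ∀ᵐ y ∂(E.Q a), p (μ, a, y) := by
  have hm : Measurable fun x : A × Y => (μ, x) := by fun_prop
  rw [period_apply, ae_map_iff hm.aemeasurable hp]
  exact Measure.ae_compProd_iff (hm hp)

theorem lintegral_period (ψ : Kernel (ProbabilityMeasure Θ) A) [IsMarkovKernel ψ]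
    (μ : ProbabilityMeasure Θ) {f : ProbabilityMeasure Θ × A × Y → ℝ≥0∞} (hf : Measurable f) :
    ∫⁻ z, f z ∂(E.period ψ μ) = ∫⁻ a, ∫⁻ y, f (μ, a, y) ∂(E.Q a) ∂(ψ μ) := by
  have hm : Measurable fun x : A × Y => (μ, x) := by fun_prop
  rw [period_apply, lintegral_map hf hm]
  exact Measure.lintegral_compProd (hf.comp hm)

theorem integral_period (ψ : Kernel (ProbabilityMeasure Θ) A) [IsMarkovKernel ψ]
    (μ : ProbabilityMeasure Θ) {f : ProbabilityMeasure Θ × A × Y → ℝ} (hf : Measurable f)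
    (hi : Integrable f (E.period ψ μ)) :
    ∫ z, f z ∂(E.period ψ μ) = ∫ a, ∫ y, f (μ, a, y) ∂(E.Q a) ∂(ψ μ) := by
  have hm : Measurable fun x : A × Y => (μ, x) := by fun_prop
  rw [period_apply] at hi ⊢
  rw [integral_map hm.aemeasurable hf.aestronglyMeasurable, Measure.integral_compProd]
  exact (integrable_map_measure hf.aestronglyMeasurable hm.aemeasurable).1 hi

variable (φ : ℕ → Kernel (ProbabilityMeasure Θ) A) [∀ t, IsMarkovKernel (φ t)]
  (μ₀ : ProbabilityMeasure Θ)

instance : IsProbabilityMeasure (E.pathLaw φ μ₀) := by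
  unfold pathLaw; infer_instance

/-- The belief before the period following a given history. -/
noncomputable def nextBelief (t : ℕ)
    (x : (i : Finset.Iic t) → ProbabilityMeasure Θ × A × Y) : ProbabilityMeasure Θ :=
  E.bayes (x ⟨t, Finset.mem_Iic.2 le_rfl⟩).1 (x ⟨t, Finset.mem_Iic.2 le_rfl⟩).2.1
    (x ⟨t, Finset.mem_Iic.2 le_rfl⟩).2.2

theorem measurable_nextBelief (t : ℕ) : Measurable (E.nextBelief t) :=
  E.measurable_bayes.comp (measurable_pi_apply _)

theorem transition_apply (t : ℕ) (x : (i : Finset.Iic t) → ProbabilityMeasure Θ × A × Y) :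
    E.transition φ t x = E.period (φ (t + 1)) (E.nextBelief t x) := rfl

theorem map_zero_pathLaw : (E.pathLaw φ μ₀).map (fun ω => ω 0) = E.period (φ 0) μ₀ :=
  Kernel.map_eval_zero_trajMeasure (X := fun _ => ProbabilityMeasure Θ × A × Y) _ _

theorem map_succ_pathLaw (t : ℕ) :
    (E.pathLaw φ μ₀).map (fun ω => (Preorder.frestrictLe t ω, ω (t + 1))) =
      (E.pathLaw φ μ₀).map (Preorder.frestrictLe t) ⊗ₘ E.transition φ t :=
  (Kernel.map_frestrictLe_trajMeasure_compProd_eq_map_trajMeasure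
    (X := fun _ => ProbabilityMeasure Θ × A × Y)).symm

/-- Disintegration of the path law at time `t`: a property holding conditionally on every history
holds almost surely. -/
theorem ae_pathLaw_succ (t : ℕ)
    {p : ((i : Finset.Iic t) → ProbabilityMeasure Θ × A × Y) → ProbabilityMeasure Θ × A × Y → Prop}
    (hp : MeasurableSet {z : ((i : Finset.Iic t) → ProbabilityMeasure Θ × A × Y) ×
      (ProbabilityMeasure Θ × A × Y) | p z.1 z.2})
    (h : ∀ x, ∀ᵐ z ∂(E.period (φ (t + 1)) (E.nextBelief t x)), p x z) :
    ∀ᵐ ω ∂(E.pathLaw φ μ₀), p (Preorder.frestrictLe t ω) (ω (t + 1)) := by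
  have hm : Measurable fun ω : ℕ → ProbabilityMeasure Θ × A × Y =>
    (Preorder.frestrictLe t ω, ω (t + 1)) := by fun_prop
  have h1 : ∀ᵐ z ∂((E.pathLaw φ μ₀).map (Preorder.frestrictLe t) ⊗ₘ E.transition φ t),
      p z.1 z.2 := (Measure.ae_compProd_iff hp).2 (Eventually.of_forall h)
  rw [← map_succ_pathLaw] at h1
  exact ae_of_ae_map hm.aemeasurable h1

theorem ae_pathLaw_forall {p : ℕ → ProbabilityMeasure Θ × A × Y → Prop}
    (hp : ∀ t, MeasurableSet {z | p t z}) (h : ∀ t μ, ∀ᵐ z ∂(E.period (φ t) μ), p t z) :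
    ∀ᵐ ω ∂(E.pathLaw φ μ₀), ∀ t, p t (ω t) := by
  refine ae_all_iff.2 fun t => ?_
  cases t with
  | zero =>
    have h1 := h 0 μ₀
    rw [← E.map_zero_pathLaw φ] at h1
    exact ae_of_ae_map (measurable_pi_apply 0).aemeasurable h1
  | succ t =>
    exact E.ae_pathLaw_succ φ μ₀ t (p := fun _ z => p (t + 1) z) (measurable_snd (hp (t + 1)))
      fun x => h (t + 1) _

/-- Beliefs are recorded as coordinates of the path, so their agreement with Bayes' rule is an
almost sure property. `MeasurableEq` makes it a measurable one. -/
theorem ae_pathLaw_belief [MeasurableEq (ProbabilityMeasure Θ)] :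
    ∀ᵐ ω ∂(E.pathLaw φ μ₀), (ω 0).1 = μ₀ ∧
      ∀ t, (ω (t + 1)).1 = E.bayes (ω t).1 (ω t).2.1 (ω t).2.2 := by
  refine Eventually.and ?_ (ae_all_iff.2 fun t => ?_)
  · have h1 : ∀ᵐ z ∂(E.period (φ 0) μ₀), z.1 = μ₀ :=
      (E.ae_period_iff _ _ (measurableSet_eq_fun measurable_fst measurable_const)).2 (by simp)
    rw [← E.map_zero_pathLaw φ] at h1
    exact ae_of_ae_map (measurable_pi_apply 0).aemeasurable h1
  · refine E.ae_pathLaw_succ φ μ₀ t (p := fun x z => z.1 = E.nextBelief t x) ?_ fun x => ?_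
    · exact measurableSet_eq_fun (measurable_fst.comp measurable_snd)
        ((E.measurable_nextBelief t).comp measurable_fst)
    · exact (E.ae_period_iff _ _ (measurableSet_eq_fun measurable_fst measurable_const)).2 (by simp)

theorem lintegral_pathLaw_le {f : ProbabilityMeasure Θ × A × Y → ℝ≥0∞} (hf : Measurable f)
    {C : ℝ≥0∞} (h : ∀ t μ, ∫⁻ z, f z ∂(E.period (φ t) μ) ≤ C) (t : ℕ) :
    ∫⁻ ω, f (ω t) ∂(E.pathLaw φ μ₀) ≤ C := by
  cases t with
  | zero =>
    have hm : Measurable fun ω : ℕ → ProbabilityMeasure Θ × A × Y => ω 0 := by fun_prop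
    rw [← lintegral_map hf hm, map_zero_pathLaw]
    exact h 0 μ₀
  | succ t =>
    have hm : Measurable fun ω : ℕ → ProbabilityMeasure Θ × A × Y =>
      (Preorder.frestrictLe t ω, ω (t + 1)) := by fun_prop
    have hf' : Measurable fun z : ((i : Finset.Iic t) → ProbabilityMeasure Θ × A × Y) ×
      (ProbabilityMeasure Θ × A × Y) => f z.2 := hf.comp measurable_snd
    rw [← lintegral_map hf' hm, map_succ_pathLaw, Measure.lintegral_compProd hf']
    refine (lintegral_mono fun x => h (t + 1) (E.nextBelief t x)).trans ?_
    have : IsProbabilityMeasure ((E.pathLaw φ μ₀).map (Preorder.frestrictLe t)) :=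
      Measure.isProbabilityMeasure_map (by fun_prop)
    simp

/-- The law of large numbers along the path for functions with conditional mean zero. -/
theorem ae_pathLaw_tendsto_average_zero {g : ProbabilityMeasure Θ × A × Y → ℝ} (hg : Measurable g)
    {C : ℝ≥0} (hC : ∀ t μ, ∫⁻ z, ENNReal.ofReal (g z ^ 2) ∂(E.period (φ t) μ) ≤ C)
    (h0 : ∀ t μ, ∫ z, g z ∂(E.period (φ t) μ) = 0) :
    ∀ᵐ ω ∂(E.pathLaw φ μ₀),
      Tendsto (fun n : ℕ => (∑ i ∈ Finset.range n, g (ω i)) / n) atTop (𝓝 0) := by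
  have hm : ∀ t, Measurable fun ω : ℕ → ProbabilityMeasure Θ × A × Y => g (ω t) := fun t =>
    hg.comp (measurable_pi_apply t)
  have hle : ∀ t, ∫⁻ ω, ENNReal.ofReal (g (ω t) ^ 2) ∂(E.pathLaw φ μ₀) ≤ C :=
    E.lintegral_pathLaw_le φ μ₀ (f := fun z => ENNReal.ofReal (g z ^ 2)) (by fun_prop) hC
  have hL : ∀ t, MemLp (fun ω => g (ω t)) 2 (E.pathLaw φ μ₀) := fun t =>
    memLp_two_of_lintegral_sq_le (hm t) (hle t)
  refine ae_tendsto_average_zero_of_orthogonal (C := C) hL (fun t => ?_) fun i j hij => ?_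
  · rw [integral_eq_lintegral_of_nonneg_ae (Eventually.of_forall fun ω => sq_nonneg _)
      ((hm t).pow_const 2).aestronglyMeasurable]
    exact ENNReal.toReal_mono ENNReal.coe_ne_top (hle t)
  · obtain ⟨t, rfl⟩ : ∃ t, j = t + 1 := ⟨j - 1, by omega⟩
    have hi : i ∈ Finset.Iic t := Finset.mem_Iic.2 (by omega)
    -- Since `i ≤ t`, the first factor is a function of the history; conditionally on it the second
    -- factor has mean zero, which gives orthogonality.
    let F : ((i : Finset.Iic t) → ProbabilityMeasure Θ × A × Y) ×
      (ProbabilityMeasure Θ × A × Y) → ℝ := fun z => g (z.1 ⟨i, hi⟩) * g z.2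
    have hF : Measurable F := by
      have h1 : Measurable fun z : ((i : Finset.Iic t) → ProbabilityMeasure Θ × A × Y) ×
        (ProbabilityMeasure Θ × A × Y) => z.1 ⟨i, hi⟩ := by fun_prop
      exact (hg.comp h1).mul (hg.comp measurable_snd)
    have hmm : Measurable fun ω : ℕ → ProbabilityMeasure Θ × A × Y =>
      (Preorder.frestrictLe t ω, ω (t + 1)) := by fun_prop
    have hint : Integrable F ((E.pathLaw φ μ₀).map
        (fun ω => (Preorder.frestrictLe t ω, ω (t + 1)))) :=
      (integrable_map_measure hF.aestronglyMeasurable hmm.aemeasurable).2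
        ((hL i).integrable_mul (hL (t + 1)))
    have h1 : ∫ ω, g (ω i) * g (ω (t + 1)) ∂(E.pathLaw φ μ₀) =
        ∫ z, F z ∂((E.pathLaw φ μ₀).map (fun ω => (Preorder.frestrictLe t ω, ω (t + 1)))) := by
      rw [integral_map hmm.aemeasurable hF.aestronglyMeasurable]
      rfl
    rw [map_succ_pathLaw] at h1 hint
    rw [h1, Measure.integral_compProd hint]
    refine integral_eq_zero_of_ae (Eventually.of_forall fun x => ?_)
    simp only [F, integral_const_mul, transition_apply, h0, mul_zero, Pi.zero_apply]

/-- The law of large numbers for functions of actions and consequences. -/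
theorem ae_pathLaw_tendsto_average {f : A × Y → ℝ} (hf : Measurable f) {C : ℝ≥0}
    (hC : ∀ a, ∫⁻ y, ENNReal.ofReal (f (a, y) ^ 2) ∂(E.Q a) ≤ C) :
    ∀ᵐ ω ∂(E.pathLaw φ μ₀),
      Tendsto (fun n : ℕ => (∑ i ∈ Finset.range n,
        (f (ω i).2 - ∫ y, f ((ω i).2.1, y) ∂(E.Q (ω i).2.1))) / n) atTop (𝓝 0) := by
  have hm : Measurable fun a => ∫ y, f (a, y) ∂(E.Q a) :=
    (hf.stronglyMeasurable.integral_kernel_prod_right' (κ := E.Q)).measurable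
  have hL : ∀ a, MemLp (fun y => f (a, y)) 2 (E.Q a) := fun a =>
    memLp_two_of_lintegral_sq_le (hf.comp measurable_prodMk_left) (hC a)
  let g : ProbabilityMeasure Θ × A × Y → ℝ := fun z => f z.2 - ∫ y, f (z.2.1, y) ∂(E.Q z.2.1)
  have hgm : Measurable g :=
    (hf.comp measurable_snd).sub (hm.comp (measurable_fst.comp measurable_snd))
  have hgC : ∀ t μ, ∫⁻ z, ENNReal.ofReal (g z ^ 2) ∂(E.period (φ t) μ) ≤ C := by
    intro t μ
    rw [E.lintegral_period (φ t) μ (f := fun z => ENNReal.ofReal (g z ^ 2)) (by fun_prop)]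
    refine (lintegral_mono (g := fun _ => (C : ℝ≥0∞)) fun a => ?_).trans (by simp)
    exact (lintegral_sq_sub_integral_le (hL a)).trans (hC a)
  refine E.ae_pathLaw_tendsto_average_zero φ μ₀ (g := g) hgm hgC fun t μ => ?_
  have hgL : MemLp g 2 (E.period (φ t) μ) := memLp_two_of_lintegral_sq_le hgm (hgC t μ)
  rw [E.integral_period (φ t) μ hgm (hgL.integrable one_le_two)]
  refine integral_eq_zero_of_ae (Eventually.of_forall fun a => ?_)
  simp only [g]
  rw [integral_sub ((hL a).integrable one_le_two) (integrable_const _)]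
  simp

end PathLaw

end LearningProblem

namespace LearningProblem

/-! ### Log-likelihood ratios -/

namespace Envelope

variable {A Θ Y : Type*} [MetricSpace A] [CompactSpace A] [MeasurableSpace A] [BorelSpace A]
  [MetricSpace Θ] [CompactSpace Θ] [MeasurableSpace Θ] [BorelSpace Θ] [MeasurableSpace Y]
  {E : LearningProblem A Θ Y} (V : E.Envelope)

/-- The log-likelihood ratio of the truth and the model, set to zero at irregular consequences. -/
noncomputable def logRatio (θ : Θ) (a : A) (y : Y) : ℝ :=
  V.G.indicator (fun y => Real.log ((E.q a y : ℝ) / E.qm θ a y)) y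

theorem logRatio_of_mem {y : Y} (hy : y ∈ V.G) (θ : Θ) (a : A) :
    V.logRatio θ a y = Real.log ((E.q a y : ℝ) / E.qm θ a y) := Set.indicator_of_mem hy _

theorem logRatio_of_notMem {y : Y} (hy : y ∉ V.G) (θ : Θ) (a : A) : V.logRatio θ a y = 0 :=
  Set.indicator_of_notMem hy _

theorem measurable_logRatio : Measurable fun p : Θ × A × Y => V.logRatio p.1 p.2.1 p.2.2 := by
  have h1 : Measurable fun p : Θ × A × Y => Real.log ((E.q p.2.1 p.2.2 : ℝ) / E.qm p.1 p.2.1 p.2.2) :=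
    Real.measurable_log.comp
      ((E.measurable_q.comp measurable_snd).coe_nnreal_real.div E.measurable_qm.coe_nnreal_real)
  exact h1.indicator ((measurable_snd.comp measurable_snd) V.measurableSet_G)

theorem measurable_logRatio_right (θ : Θ) : Measurable fun p : A × Y => V.logRatio θ p.1 p.2 :=
  V.measurable_logRatio.comp (measurable_const.prodMk measurable_id)

theorem measurable_logRatio_left (a : A) (y : Y) : Measurable fun θ => V.logRatio θ a y :=
  V.measurable_logRatio.comp (measurable_id.prodMk (measurable_const (a := (a, y))))

theorem log_M_nonneg (y : Y) : 0 ≤ Real.log (V.M y) :=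
  Real.log_nonneg (by exact_mod_cast V.one_le_M y)

theorem log_M_le (y : Y) : Real.log (V.M y) ≤ V.M y := by
  have : (0 : ℝ) < V.M y := by exact_mod_cast one_pos.trans_le (V.one_le_M y)
  linarith [Real.log_le_sub_one_of_pos this]

/-- From `log √M ≤ √M`. This is why a first moment of `M` yields second moments of log-likelihood
ratios. -/
theorem log_M_sq_le (y : Y) : Real.log (V.M y) ^ 2 ≤ 4 * V.M y := by
  have h1 : (0 : ℝ) < V.M y := by exact_mod_cast one_pos.trans_le (V.one_le_M y)
  have h2 := Real.log_le_sub_one_of_pos (Real.sqrt_pos.2 h1)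
  rw [Real.log_sqrt h1.le] at h2
  have h3 : Real.log (V.M y) ≤ 2 * √(V.M y) := by linarith
  calc Real.log (V.M y) ^ 2 ≤ (2 * √(V.M y)) ^ 2 := by
        have := V.log_M_nonneg y
        gcongr
    _ = 4 * (V.M y : ℝ) := by rw [mul_pow, Real.sq_sqrt h1.le]; norm_num

theorem qm_pos {y : Y} (hy : y ∈ V.G) {a : A} (hq : E.q a y ≠ 0) (θ : Θ) : 0 < E.qm θ a y := by
  refine pos_iff_ne_zero.2 fun h => hq ?_
  have := V.q_le_qm y hy θ a
  rw [h, zero_mul] at this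
  exact le_antisymm this zero_le

theorem abs_logRatio_le (θ : Θ) (a : A) (y : Y) : |V.logRatio θ a y| ≤ Real.log (V.M y) := by
  by_cases hy : y ∈ V.G
  swap
  · simpa [V.logRatio_of_notMem hy] using V.log_M_nonneg y
  rw [V.logRatio_of_mem hy]
  -- At `q = 0` the quotient is zero and `Real.log 0 = 0`, so the bound survives.
  by_cases hq : E.q a y = 0
  · simpa [hq] using V.log_M_nonneg y
  have hq' : (0 : ℝ) < E.q a y := by exact_mod_cast pos_iff_ne_zero.2 hq
  have hm : (0 : ℝ) < E.qm θ a y := by exact_mod_cast V.qm_pos hy hq θ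
  have hM : (0 : ℝ) < V.M y := by exact_mod_cast one_pos.trans_le (V.one_le_M y)
  have h1 : (E.q a y : ℝ) ≤ E.qm θ a y * V.M y := by exact_mod_cast V.q_le_qm y hy θ a
  have h2 : (E.qm θ a y : ℝ) ≤ E.q a y * V.M y := by exact_mod_cast V.qm_le y hy θ a
  rw [abs_le, ← Real.log_inv]
  constructor
  · refine Real.log_le_log (by positivity) ?_
    rw [inv_le_comm₀ hM (by positivity), inv_div, div_le_iff₀ hq']
    linarith
  · refine Real.log_le_log (by positivity) ?_
    rw [div_le_iff₀ hm]
    linarith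

/-- Where `q` vanishes the envelope forces `q_θ` to vanish too, so the identity needs no exception
on `G`. -/
theorem qm_eq {y : Y} (hy : y ∈ V.G) (θ : Θ) (a : A) :
    (E.qm θ a y : ℝ) = E.q a y * Real.exp (-V.logRatio θ a y) := by
  by_cases hq : E.q a y = 0
  · have := V.qm_le y hy θ a
    rw [hq, zero_mul] at this
    simp [hq, le_antisymm this zero_le]
  have hq' : (0 : ℝ) < E.q a y := by exact_mod_cast pos_iff_ne_zero.2 hq
  have hm : (0 : ℝ) < E.qm θ a y := by exact_mod_cast V.qm_pos hy hq θ
  rw [V.logRatio_of_mem hy, Real.exp_neg, Real.exp_log (by positivity)]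
  field_simp

/-- The logarithm alone may be discontinuous in the action where `q` vanishes; the weight `q`
squeezes the product to zero there, because the ratio is bounded by `log M`. -/
theorem continuous_q_mul_logRatio {y : Y} (hy : y ∈ V.G) :
    Continuous fun p : Θ × A => E.q p.2 y * V.logRatio p.1 p.2 y := by
  have hq : Continuous fun p : Θ × A => (E.q p.2 y : ℝ) :=
    NNReal.continuous_coe.comp ((V.continuous_q y hy).comp continuous_snd)
  have hm : Continuous fun p : Θ × A => (E.qm p.1 p.2 y : ℝ) :=
    NNReal.continuous_coe.comp (V.continuous_qm y hy)
  refine continuous_iff_continuousAt.2 fun p => ?_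
  by_cases hp : E.q p.2 y = 0
  · have h1 : Tendsto (fun p : Θ × A => E.q p.2 y * Real.log (V.M y)) (𝓝 p) (𝓝 0) := by
      have := (hq.mul_const (Real.log (V.M y))).tendsto p
      simpa only [hp, NNReal.coe_zero, zero_mul] using this
    have h2 : Tendsto (fun p : Θ × A => E.q p.2 y * V.logRatio p.1 p.2 y) (𝓝 p) (𝓝 0) := by
      refine squeeze_zero_norm (fun p => ?_) h1
      rw [norm_mul, Real.norm_eq_abs, Real.norm_eq_abs, abs_of_nonneg (NNReal.coe_nonneg _)]
      exact mul_le_mul_of_nonneg_left (V.abs_logRatio_le _ _ _) (NNReal.coe_nonneg _)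
    rw [ContinuousAt]
    simpa [hp] using h2
  · have hm0 : (E.qm p.1 p.2 y : ℝ) ≠ 0 := by simpa using (V.qm_pos hy hp p.1).ne'
    have hq0 : (E.q p.2 y : ℝ) ≠ 0 := by simpa using hp
    simp_rw [V.logRatio_of_mem hy]
    exact hq.continuousAt.mul ((hq.continuousAt.div hm.continuousAt hm0).log (div_ne_zero hq0 hm0))

theorem continuous_logRatio {y : Y} (hy : y ∈ V.G) {a : A} (hq : E.q a y ≠ 0) :
    Continuous fun θ => V.logRatio θ a y := by
  have h : Continuous fun θ : Θ => (E.q a y : ℝ)⁻¹ * (E.q a y * V.logRatio θ a y) :=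
    continuous_const.mul ((V.continuous_q_mul_logRatio hy).comp (by fun_prop : Continuous fun θ : Θ =>
      (θ, a)))
  have hq' : (E.q a y : ℝ) ≠ 0 := by simpa using hq
  simpa [inv_mul_cancel_left₀ hq'] using h

theorem abs_q_mul_le {y : Y} (hy : y ∈ V.G) (a : A) {x c : ℝ} (hx : |x| ≤ c * Real.log (V.M y))
    (hc : 0 ≤ c) : |E.q a y * x| ≤ c * (V.M y * V.r y) := by
  have h1 : (E.q a y : ℝ) ≤ V.r y := by exact_mod_cast V.q_le y hy a
  have h2 := V.log_M_le y
  have h3 := V.log_M_nonneg y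
  rw [abs_mul, abs_of_nonneg (NNReal.coe_nonneg _)]
  calc (E.q a y : ℝ) * |x| ≤ V.r y * (c * V.M y) := by
        refine mul_le_mul h1 (hx.trans ?_) (abs_nonneg _) (NNReal.coe_nonneg _)
        gcongr
    _ = _ := by ring

theorem integral_Q (a : A) (f : Y → ℝ) : ∫ y, f y ∂(E.Q a) = ∫ y, E.q a y * f y ∂E.ν := by
  rw [E.Q_eq, integral_withDensity_eq_integral_smul (E.measurable_q_right a)]
  rfl

theorem ae_Q_mem (a : A) : ∀ᵐ y ∂(E.Q a), y ∈ V.G := by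
  rw [E.Q_eq]
  exact (withDensity_absolutelyContinuous _ _).ae_le V.ae_mem

theorem ae_Q_ne_zero (E : LearningProblem A Θ Y) (a : A) : ∀ᵐ y ∂(E.Q a), E.q a y ≠ 0 := by
  rw [E.Q_eq, ae_withDensity_iff (E.measurable_q_right a).coe_nnreal_ennreal]
  exact Eventually.of_forall fun y hy => by simpa using hy

/-- The Kullback–Leibler divergence as a real number. -/
noncomputable def meanLogRatio (θ : Θ) (a : A) : ℝ := ∫ y, V.logRatio θ a y ∂(E.Q a)

theorem continuous_meanLogRatio : Continuous fun p : Θ × A => V.meanLogRatio p.1 p.2 := by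
  simp_rw [meanLogRatio, integral_Q]
  refine continuous_of_dominated (bound := fun y => 1 * (V.M y * V.r y)) (fun p => ?_) (fun p => ?_)
    (V.integrable_M_r.const_mul 1) ?_
  · exact ((E.measurable_q_right p.2).coe_nnreal_real.mul
      ((V.measurable_logRatio_right p.1).comp measurable_prodMk_left)).aestronglyMeasurable
  · filter_upwards [V.ae_mem] with y hy
    exact V.abs_q_mul_le hy p.2 (by simpa using V.abs_logRatio_le p.1 p.2 y) zero_le_one
  · filter_upwards [V.ae_mem] with y hy
    exact V.continuous_q_mul_logRatio hy

/-- The bound does not depend on the action, since `q ≤ r` and `(log M)² ≤ 4 M`. -/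
theorem lintegral_sq_le {f : A × Y → ℝ} {c : ℝ}
    (hfc : ∀ a y, |f (a, y)| ≤ c * Real.log (V.M y)) (a : A) :
    ∫⁻ y, ENNReal.ofReal (f (a, y) ^ 2) ∂(E.Q a) ≤
      (Real.toNNReal (∫ y, 4 * c ^ 2 * (V.M y * V.r y) ∂E.ν) : ℝ≥0) := by
  have hi := V.integrable_M_r.const_mul (4 * c ^ 2)
  have h0 : ∀ y, 0 ≤ 4 * c ^ 2 * (V.M y * V.r y : ℝ) := fun y => by positivity
  change _ ≤ ENNReal.ofReal _
  rw [ofReal_integral_eq_lintegral_ofReal hi (Eventually.of_forall h0), E.Q_eq,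
    lintegral_withDensity_eq_lintegral_mul_non_measurable _
      (E.measurable_q_right a).coe_nnreal_ennreal (Eventually.of_forall fun y => by simp)]
  refine lintegral_mono_ae ?_
  filter_upwards [V.ae_mem] with y hy
  have h1 : (E.q a y : ℝ) ≤ V.r y := by exact_mod_cast V.q_le y hy a
  have h2 : f (a, y) ^ 2 ≤ c ^ 2 * (4 * V.M y) := by
    calc f (a, y) ^ 2 = |f (a, y)| ^ 2 := (sq_abs _).symm
      _ ≤ (c * Real.log (V.M y)) ^ 2 := by gcongr; exact hfc a y
      _ = c ^ 2 * Real.log (V.M y) ^ 2 := by ring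
      _ ≤ _ := by gcongr; exact V.log_M_sq_le y
  rw [Pi.mul_apply, ← ENNReal.ofReal_coe_nnreal, ← ENNReal.ofReal_mul (NNReal.coe_nonneg _)]
  refine ENNReal.ofReal_le_ofReal ?_
  calc (E.q a y : ℝ) * f (a, y) ^ 2 ≤ V.r y * (c ^ 2 * (4 * V.M y)) := by gcongr
    _ = _ := by ring

theorem integrable_logRatio (θ : Θ) (a : A) : Integrable (fun y => V.logRatio θ a y) (E.Q a) :=
  (memLp_two_of_lintegral_sq_le ((V.measurable_logRatio_right θ).comp measurable_prodMk_left)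
    (V.lintegral_sq_le (f := fun p => V.logRatio θ p.1 p.2) (c := 1)
      (fun a y => by simpa using V.abs_logRatio_le θ a y) a)).integrable one_le_two

theorem Q_eq_withDensity (θ : Θ) (a : A) :
    E.Q a = (E.Qm (θ, a)).withDensity fun y => ENNReal.ofReal (Real.exp (V.logRatio θ a y)) := by
  have hm : Measurable fun y => ENNReal.ofReal (Real.exp (V.logRatio θ a y)) :=
    (Real.measurable_exp.comp
      ((V.measurable_logRatio_right θ).comp measurable_prodMk_left)).ennreal_ofReal
  rw [E.Q_eq, E.Qm_eq, ← withDensity_mul _ (E.measurable_qm_right θ a).coe_nnreal_ennreal hm]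
  refine withDensity_congr_ae ?_
  filter_upwards [V.ae_mem] with y hy
  rw [Pi.mul_apply, ← ENNReal.ofReal_coe_nnreal, ← ENNReal.ofReal_coe_nnreal,
    ← ENNReal.ofReal_mul (NNReal.coe_nonneg _), V.qm_eq hy, mul_assoc, ← Real.exp_add]
  simp

theorem llr_ae_eq (θ : Θ) (a : A) :
    llr (E.Q a) (E.Qm (θ, a)) =ᵐ[E.Q a] fun y => V.logRatio θ a y := by
  have hm : Measurable fun y => ENNReal.ofReal (Real.exp (V.logRatio θ a y)) :=
    (Real.measurable_exp.comp
      ((V.measurable_logRatio_right θ).comp measurable_prodMk_left)).ennreal_ofReal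
  have h1 : (E.Q a).rnDeriv (E.Qm (θ, a)) =ᵐ[E.Qm (θ, a)]
      fun y => ENNReal.ofReal (Real.exp (V.logRatio θ a y)) := by
    conv_lhs => rw [V.Q_eq_withDensity θ a]
    exact Measure.rnDeriv_withDensity _ hm
  have hac : E.Q a ≪ E.Qm (θ, a) := by
    rw [V.Q_eq_withDensity θ a]
    exact withDensity_absolutelyContinuous _ _
  filter_upwards [hac.ae_le h1] with y hy
  rw [llr, hy, ENNReal.toReal_ofReal (Real.exp_pos _).le, Real.log_exp]

/-- The log-likelihood ratio is integrable under the truth, so the divergence is finite and equals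
its mean; nonnegativity is Gibbs' inequality. -/
theorem kl_eq (θ : Θ) (a : A) :
    0 ≤ V.meanLogRatio θ a ∧ E.kl θ a = ENNReal.ofReal (V.meanLogRatio θ a) := by
  have hac : E.Q a ≪ E.Qm (θ, a) := by
    rw [V.Q_eq_withDensity θ a]
    exact withDensity_absolutelyContinuous _ _
  have hl := V.llr_ae_eq θ a
  have hi : Integrable (llr (E.Q a) (E.Qm (θ, a))) (E.Q a) :=
    (V.integrable_logRatio θ a).congr hl.symm
  have h1 := InformationTheory.integral_llr_add_sub_measure_univ_nonneg hac hi
  have h2 := InformationTheory.klDiv_of_ac_of_integrable hac hi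
  rw [integral_congr_ae hl] at h1 h2
  simp only [probReal_univ, add_sub_cancel_right] at h1 h2
  exact ⟨h1, h2⟩

/-- The `σ`-average of the Kullback–Leibler divergence. -/
noncomputable def averageKL (σ : ProbabilityMeasure A) (θ : Θ) : ℝ :=
  ∫ a, V.meanLogRatio θ a ∂(σ : Measure A)

theorem continuous_averageKL (σ : ProbabilityMeasure A) : Continuous (V.averageKL σ) := by
  have h : Continuous fun p : A × Θ => V.meanLogRatio p.2 p.1 :=
    V.continuous_meanLogRatio.comp continuous_swap
  exact (ProbabilityMeasure.continuous_integral_prod (f := fun a θ => V.meanLogRatio θ a) h).comp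
    (f := fun θ => (σ, θ)) (by fun_prop)

theorem mem_klMinimizers_iff (σ : ProbabilityMeasure A) (θ : Θ) :
    θ ∈ E.klMinimizers σ ↔ ∀ θ', V.averageKL σ θ ≤ V.averageKL σ θ' := by
  have h : ∀ θ, ∫⁻ a, E.kl θ a ∂(σ : Measure A) = ENNReal.ofReal (V.averageKL σ θ) := fun θ => by
    have hc : Continuous (V.meanLogRatio θ) :=
      V.continuous_meanLogRatio.comp (f := fun a => (θ, a)) (by fun_prop)
    have hi : Integrable (V.meanLogRatio θ) (σ : Measure A) :=
      (BoundedContinuousFunction.mkOfCompact ⟨_, hc⟩).integrable _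
    rw [averageKL, ofReal_integral_eq_lintegral_ofReal hi
      (Eventually.of_forall fun a => (V.kl_eq θ a).1)]
    exact lintegral_congr fun a => (V.kl_eq θ a).2
  have h0 : ∀ θ, 0 ≤ V.averageKL σ θ := fun θ => integral_nonneg fun a => (V.kl_eq θ a).1
  simp only [klMinimizers, Set.mem_ofPred_eq, h, ENNReal.ofReal_le_ofReal_iff (h0 _)]

end Envelope

end LearningProblem

/-! ### Averages along empirical distributions -/

theorem integral_empiricalDistribution {A : Type*} [MeasurableSpace A] (a : ℕ → A) (t : ℕ)
    {f : A → ℝ} (hf : Measurable f) :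
    ∫ x, f x ∂(empiricalDistribution a t : Measure A) =
      (∑ i ∈ Finset.range (t + 1), f (a i)) / (t + 1 : ℕ) := by
  have h : (empiricalDistribution a t : Measure A) =
      ((t : ℝ≥0∞) + 1)⁻¹ • ∑ i ∈ Finset.range (t + 1), Measure.dirac (a i) := rfl
  rw [h, integral_smul_measure, integral_finsetSum_measure fun i _ => ?_]
  · simp_rw [integral_dirac' f _ hf.stronglyMeasurable]
    rw [ENNReal.toReal_inv, ENNReal.toReal_add (by simp) (by simp)]
    simp [div_eq_inv_mul]
  · exact integrable_dirac' hf.stronglyMeasurable (by simp)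

theorem tendsto_average_of_tendsto_empiricalDistribution {A : Type*} [TopologicalSpace A]
    [CompactSpace A] [MeasurableSpace A] [BorelSpace A] {a : ℕ → A} {σ : ProbabilityMeasure A}
    (h : Tendsto (empiricalDistribution a) atTop (𝓝 σ)) {f : A → ℝ} (hf : Continuous f) :
    Tendsto (fun n : ℕ => (∑ i ∈ Finset.range n, f (a i)) / n) atTop
      (𝓝 (∫ x, f x ∂(σ : Measure A))) := by
  have h1 := ProbabilityMeasure.tendsto_iff_forall_integral_tendsto.1 h
    (BoundedContinuousFunction.mkOfCompact ⟨f, hf⟩)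
  -- `empiricalDistribution a t` averages `t + 1` terms, hence the shift of the index.
  refine (tendsto_add_atTop_iff_nat 1).1 (h1.congr fun t => ?_)
  exact integral_empiricalDistribution a t hf.measurable

namespace LearningProblem

namespace Envelope

variable {A Θ Y : Type*} [MetricSpace A] [CompactSpace A] [MeasurableSpace A] [BorelSpace A]
  [MetricSpace Θ] [CompactSpace Θ] [MeasurableSpace Θ] [BorelSpace Θ] [MeasurableSpace Y]
  {E : LearningProblem A Θ Y} (V : E.Envelope)

/-! ### Oscillation of the log-likelihood ratio -/

section Oscillation

variable [Nonempty Θ]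

open TopologicalSpace in
/-- The oscillation of the log-likelihood ratio over pairs of parameters at distance less than
`1 / (n + 1)`, computed along a dense sequence. -/
noncomputable def osc (n : ℕ) (a : A) (y : Y) : ℝ :=
  ⨆ p : ℕ × ℕ, if dist (denseSeq Θ p.1) (denseSeq Θ p.2) < 1 / ((n : ℝ) + 1) then
    |V.logRatio (denseSeq Θ p.1) a y - V.logRatio (denseSeq Θ p.2) a y| else 0

theorem abs_logRatio_sub_le (θ θ' : Θ) (a : A) (y : Y) :
    |V.logRatio θ a y - V.logRatio θ' a y| ≤ 2 * Real.log (V.M y) := by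
  have h1 := V.abs_logRatio_le θ a y
  have h2 := V.abs_logRatio_le θ' a y
  exact (abs_sub _ _).trans (by linarith)

theorem osc_term_le (n : ℕ) (a : A) (y : Y) (p : Θ × Θ) :
    (if dist p.1 p.2 < 1 / ((n : ℝ) + 1) then |V.logRatio p.1 a y - V.logRatio p.2 a y| else 0) ≤
      2 * Real.log (V.M y) := by
  split_ifs
  · exact V.abs_logRatio_sub_le _ _ _ _
  · have := V.log_M_nonneg y
    positivity

open TopologicalSpace in
theorem bddAbove_osc (n : ℕ) (a : A) (y : Y) :
    BddAbove (Set.range fun p : ℕ × ℕ =>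
      if dist (denseSeq Θ p.1) (denseSeq Θ p.2) < 1 / ((n : ℝ) + 1) then
        |V.logRatio (denseSeq Θ p.1) a y - V.logRatio (denseSeq Θ p.2) a y| else 0) :=
  ⟨2 * Real.log (V.M y), by
    rintro _ ⟨p, rfl⟩
    exact V.osc_term_le n a y (denseSeq Θ p.1, denseSeq Θ p.2)⟩

open TopologicalSpace in
theorem measurable_osc (n : ℕ) : Measurable fun p : A × Y => V.osc n p.1 p.2 := by
  refine Measurable.iSup fun p => ?_
  split_ifs
  · exact ((V.measurable_logRatio_right _).sub (V.measurable_logRatio_right _)).abs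
  · exact measurable_const

theorem osc_nonneg (n : ℕ) (a : A) (y : Y) : 0 ≤ V.osc n a y :=
  Real.iSup_nonneg fun p => by split_ifs <;> positivity

open TopologicalSpace in
theorem abs_osc_le (n : ℕ) (a : A) (y : Y) : |V.osc n a y| ≤ 2 * Real.log (V.M y) := by
  rw [abs_of_nonneg (V.osc_nonneg n a y)]
  exact ciSup_le fun p => V.osc_term_le n a y (denseSeq Θ p.1, denseSeq Θ p.2)

open TopologicalSpace in
-- Pairs from the dense sequence are dense in the open set of close pairs, and the bound is closed
-- by continuity in `θ`. The supremum over a countable family, chosen for measurability, therefore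
-- loses nothing.
theorem abs_logRatio_sub_le_osc {y : Y} (hy : y ∈ V.G) {a : A} (hq : E.q a y ≠ 0) {n : ℕ}
    {θ θ' : Θ} (h : dist θ θ' < 1 / ((n : ℝ) + 1)) :
    |V.logRatio θ a y - V.logRatio θ' a y| ≤ V.osc n a y := by
  have hc := V.continuous_logRatio hy hq
  set S : Set (Θ × Θ) := {p | dist p.1 p.2 < 1 / ((n : ℝ) + 1)}
  have hS : IsOpen S := isOpen_lt (by fun_prop) (by fun_prop)
  have hd : DenseRange (Prod.map (denseSeq Θ) (denseSeq Θ)) :=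
    (denseRange_denseSeq Θ).prodMap (denseRange_denseSeq Θ)
  have hcl : IsClosed {p : Θ × Θ | |V.logRatio p.1 a y - V.logRatio p.2 a y| ≤ V.osc n a y} :=
    isClosed_le ((hc.comp continuous_fst).sub (hc.comp continuous_snd)).abs continuous_const
  have hsub : S ∩ Set.range (Prod.map (denseSeq Θ) (denseSeq Θ)) ⊆
      {p : Θ × Θ | |V.logRatio p.1 a y - V.logRatio p.2 a y| ≤ V.osc n a y} := by
    rintro _ ⟨hpS, p, rfl⟩
    have hpS' : dist (denseSeq Θ p.1) (denseSeq Θ p.2) < 1 / ((n : ℝ) + 1) := hpS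
    have := le_ciSup (V.bddAbove_osc n a y) p
    simp only [if_pos hpS'] at this
    exact this
  exact closure_minimal hsub hcl (hd.open_subset_closure_inter hS (show (θ, θ') ∈ S from h))

variable [Nonempty A]

open TopologicalSpace in
/-- A bound for the oscillation weighted by the true density, uniform in the action. -/
noncomputable def modulus (n : ℕ) (y : Y) : ℝ :=
  ⨆ p : (ℕ × ℕ) × ℕ, if dist (denseSeq Θ p.1.1) (denseSeq Θ p.1.2) < 1 / ((n : ℝ) + 1) then
    |E.q (denseSeq A p.2) y * (V.logRatio (denseSeq Θ p.1.1) (denseSeq A p.2) y -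
      V.logRatio (denseSeq Θ p.1.2) (denseSeq A p.2) y)| else 0

theorem modulus_term_le (n : ℕ) (y : Y) (θ θ' : Θ) (a : A) :
    (if dist θ θ' < 1 / ((n : ℝ) + 1) then
      |E.q a y * (V.logRatio θ a y - V.logRatio θ' a y)| else 0) ≤ 2 * (V.M y * V.r y) := by
  split_ifs
  · by_cases hy : y ∈ V.G
    · exact V.abs_q_mul_le hy a (V.abs_logRatio_sub_le _ _ _ _) zero_le_two
    · simp only [V.logRatio_of_notMem hy, sub_zero, mul_zero, abs_zero]
      positivity
  · positivity

open TopologicalSpace in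
theorem bddAbove_modulus (n : ℕ) (y : Y) :
    BddAbove (Set.range fun p : (ℕ × ℕ) × ℕ =>
      if dist (denseSeq Θ p.1.1) (denseSeq Θ p.1.2) < 1 / ((n : ℝ) + 1) then
        |E.q (denseSeq A p.2) y * (V.logRatio (denseSeq Θ p.1.1) (denseSeq A p.2) y -
          V.logRatio (denseSeq Θ p.1.2) (denseSeq A p.2) y)| else 0) :=
  ⟨2 * (V.M y * V.r y), by
    rintro _ ⟨_, rfl⟩
    exact V.modulus_term_le n y _ _ _⟩

theorem modulus_nonneg (n : ℕ) (y : Y) : 0 ≤ V.modulus n y :=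
  Real.iSup_nonneg fun p => by split_ifs <;> positivity

theorem modulus_le (n : ℕ) (y : Y) : V.modulus n y ≤ 2 * (V.M y * V.r y) :=
  ciSup_le fun _ => V.modulus_term_le n y _ _ _

theorem measurable_modulus (n : ℕ) : Measurable (V.modulus n) := by
  refine Measurable.iSup fun p => ?_
  split_ifs
  · have h : ∀ θ a, Measurable fun y => V.logRatio θ a y := fun θ a =>
      (V.measurable_logRatio_right θ).comp measurable_prodMk_left
    exact ((E.measurable_q_right _).coe_nnreal_real.mul ((h _ _).sub (h _ _))).abs
  · exact measurable_const

theorem integrable_modulus (n : ℕ) : Integrable (V.modulus n) E.ν :=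
  (V.integrable_M_r.const_mul 2).mono' (V.measurable_modulus n).aestronglyMeasurable
    (Eventually.of_forall fun y => by
      rw [Real.norm_eq_abs, abs_of_nonneg (V.modulus_nonneg n y)]
      exact V.modulus_le n y)

open TopologicalSpace in
-- The nonnegative weight moves inside the supremum; continuity of the weighted ratio in the action
-- passes from the dense sequence of actions to all of them.
theorem q_mul_osc_le {y : Y} (hy : y ∈ V.G) (n : ℕ) (a : A) :
    E.q a y * V.osc n a y ≤ V.modulus n y := by
  rw [osc, Real.mul_iSup_of_nonneg (NNReal.coe_nonneg _)]
  refine ciSup_le fun p => ?_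
  split_ifs with hp
  swap
  · simpa using V.modulus_nonneg n y
  have hf : ∀ θ : Θ, Continuous fun a => E.q a y * V.logRatio θ a y := fun θ =>
    (V.continuous_q_mul_logRatio hy).comp (f := fun a => (θ, a)) (by fun_prop)
  have hc : Continuous fun a => |E.q a y * (V.logRatio (denseSeq Θ p.1) a y -
      V.logRatio (denseSeq Θ p.2) a y)| := by
    simp_rw [mul_sub]
    exact ((hf _).sub (hf _)).abs
  have h1 : ∀ a, |E.q a y * (V.logRatio (denseSeq Θ p.1) a y -
      V.logRatio (denseSeq Θ p.2) a y)| ≤ V.modulus n y := by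
    have hcl := isClosed_le hc (continuous_const (y := V.modulus n y))
    have hsub : Set.range (denseSeq A) ⊆ {a | |E.q a y * (V.logRatio (denseSeq Θ p.1) a y -
        V.logRatio (denseSeq Θ p.2) a y)| ≤ V.modulus n y} := by
      rintro _ ⟨j, rfl⟩
      have := le_ciSup (V.bddAbove_modulus n y) (p, j)
      simp only [if_pos hp] at this
      exact this
    exact fun a => hcl.closure_subset_iff.2 hsub (denseRange_denseSeq A a)
  have h2 := h1 a
  rwa [abs_mul, abs_of_nonneg (NNReal.coe_nonneg _)] at h2

/-- Uniform continuity of the weighted log-likelihood ratio on the compact product `Θ × A`. -/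
theorem tendsto_modulus {y : Y} (hy : y ∈ V.G) :
    Tendsto (fun n => V.modulus n y) atTop (𝓝 0) := by
  have huc := CompactSpace.uniformContinuous_of_continuous (V.continuous_q_mul_logRatio hy)
  refine Metric.tendsto_atTop.2 fun ε hε => ?_
  obtain ⟨η, hη, h⟩ := Metric.uniformContinuous_iff.1 huc (ε / 2) (by positivity)
  obtain ⟨N, hN⟩ := exists_nat_one_div_lt hη
  refine ⟨N, fun n hn => ?_⟩
  rw [Real.dist_eq, sub_zero, abs_of_nonneg (V.modulus_nonneg n y)]
  refine lt_of_le_of_lt (ciSup_le fun p => ?_) (half_lt_self hε)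
  split_ifs with hp
  · have h1 : 1 / ((n : ℝ) + 1) ≤ 1 / ((N : ℝ) + 1) := by gcongr
    rw [mul_sub, ← Real.dist_eq]
    refine (h (a := (_, _)) (b := (_, _)) ?_).le
    rw [Prod.dist_eq]
    exact max_lt ((hp.trans_le h1).trans hN) (by simpa using hη)
  · positivity

theorem tendsto_integral_modulus :
    Tendsto (fun n => ∫ y, V.modulus n y ∂E.ν) atTop (𝓝 0) := by
  have h := tendsto_integral_of_dominated_convergence (F := V.modulus) (f := fun _ => 0)
    (μ := E.ν) (fun y => 2 * (V.M y * V.r y)) (fun n => (V.measurable_modulus n).aestronglyMeasurable)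
    (V.integrable_M_r.const_mul 2) (fun n => Eventually.of_forall fun y => by
      rw [Real.norm_eq_abs, abs_of_nonneg (V.modulus_nonneg n y)]
      exact V.modulus_le n y) (by
      filter_upwards [V.ae_mem] with y hy
      exact V.tendsto_modulus hy)
  simpa using h

theorem integral_osc_le (n : ℕ) (a : A) :
    ∫ y, V.osc n a y ∂(E.Q a) ≤ ∫ y, V.modulus n y ∂E.ν := by
  rw [integral_Q]
  refine integral_mono_of_nonneg (Eventually.of_forall fun y => ?_) (V.integrable_modulus n) ?_
  · exact mul_nonneg (NNReal.coe_nonneg _) (V.osc_nonneg n a y)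
  · filter_upwards [V.ae_mem] with y hy
    exact V.q_mul_osc_le hy n a

/-! ### The uniform law of large numbers -/

/-- Paths of actions and consequences along which the laws of large numbers hold. -/
structure IsTypical (x : ℕ → A × Y) : Prop where
  mem : ∀ t, (x t).2 ∈ V.G
  q_ne_zero : ∀ t, E.q (x t).1 (x t).2 ≠ 0
  logRatio : ∀ j, Tendsto (fun n : ℕ => (∑ i ∈ Finset.range n,
    (V.logRatio (TopologicalSpace.denseSeq Θ j) (x i).1 (x i).2 -
      V.meanLogRatio (TopologicalSpace.denseSeq Θ j) (x i).1)) / n) atTop (𝓝 0)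
  osc : ∀ k, Tendsto (fun n : ℕ => (∑ i ∈ Finset.range n,
    (V.osc k (x i).1 (x i).2 - ∫ y, V.osc k (x i).1 y ∂(E.Q (x i).1))) / n) atTop (𝓝 0)

/-- Countably many laws of large numbers, none involving a limit `σ`; this allows the almost sure
event to be fixed before `σ` is chosen. -/
theorem ae_isTypical (φ : ℕ → Kernel (ProbabilityMeasure Θ) A) [∀ t, IsMarkovKernel (φ t)]
    (μ₀ : ProbabilityMeasure Θ) :
    ∀ᵐ ω ∂(E.pathLaw φ μ₀), V.IsTypical fun t => (ω t).2 := by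
  have hG : MeasurableSet {z : ProbabilityMeasure Θ × A × Y | z.2.2 ∈ V.G} :=
    (measurable_snd.comp measurable_snd) V.measurableSet_G
  have hq : MeasurableSet {z : ProbabilityMeasure Θ × A × Y | E.q z.2.1 z.2.2 ≠ 0} :=
    (E.measurable_q.comp measurable_snd) (measurableSet_singleton 0).compl
  have h1 := E.ae_pathLaw_forall φ μ₀ (p := fun _ z => z.2.2 ∈ V.G) (fun _ => hG) fun t μ =>
    (E.ae_period_iff (φ t) μ hG).2 (Eventually.of_forall fun a => V.ae_Q_mem a)
  have h2 := E.ae_pathLaw_forall φ μ₀ (p := fun _ z => E.q z.2.1 z.2.2 ≠ 0) (fun _ => hq) fun t μ =>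
    (E.ae_period_iff (φ t) μ hq).2 (Eventually.of_forall fun a => ae_Q_ne_zero E a)
  have h3 := ae_all_iff.2 fun j => E.ae_pathLaw_tendsto_average φ μ₀
    (V.measurable_logRatio_right (TopologicalSpace.denseSeq Θ j)) (V.lintegral_sq_le (c := 1)
      (f := fun p => V.logRatio (TopologicalSpace.denseSeq Θ j) p.1 p.2) (fun a y => by simpa using V.abs_logRatio_le _ a y))
  have h4 := ae_all_iff.2 fun k => E.ae_pathLaw_tendsto_average φ μ₀
    (V.measurable_osc k) (V.lintegral_sq_le (c := 2) (f := fun p => V.osc k p.1 p.2) (fun a y => V.abs_osc_le k a y))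
  filter_upwards [h1, h2, h3, h4] with ω w1 w2 w3 w4
  exact ⟨w1, w2, w3, w4⟩

open TopologicalSpace in
/-- The normalized log-likelihood ratio converges uniformly in the parameter. -/
theorem IsTypical.eventually_abs_sub_lt {V : E.Envelope} {x : ℕ → A × Y} (hx : V.IsTypical x)
    {σ : ProbabilityMeasure A} (hσ : Tendsto (empiricalDistribution fun t => (x t).1) atTop (𝓝 σ))
    {ε : ℝ} (hε : 0 < ε) :
    ∀ᶠ n : ℕ in atTop, ∀ θ,
      |(∑ i ∈ Finset.range n, V.logRatio θ (x i).1 (x i).2) / n - V.averageKL σ θ| < ε := by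
  have hdense : ∀ j, Tendsto (fun n : ℕ => (∑ i ∈ Finset.range n,
      V.logRatio (denseSeq Θ j) (x i).1 (x i).2) / n) atTop (𝓝 (V.averageKL σ (denseSeq Θ j))) := by
    intro j
    have hc : Continuous (V.meanLogRatio (denseSeq Θ j)) :=
      V.continuous_meanLogRatio.comp (f := fun a => (denseSeq Θ j, a)) (by fun_prop)
    have h := (hx.logRatio j).add (tendsto_average_of_tendsto_empiricalDistribution hσ hc)
    rw [zero_add] at h
    refine h.congr fun n => ?_
    rw [← add_div, ← Finset.sum_add_distrib]
    simp
  -- Error budget: `ε / 4` for the continuity of `averageKL`, `ε / 4` for convergence on a finite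
  -- net, and `ε / 4` for the averaged oscillation, split equally between its mean and the
  -- fluctuation around it.
  have huc := CompactSpace.uniformContinuous_of_continuous (V.continuous_averageKL σ)
  obtain ⟨η, hη, hκ⟩ := Metric.uniformContinuous_iff.1 huc (ε / 4) (by positivity)
  obtain ⟨k, hk1, hk2⟩ : ∃ k : ℕ, 1 / ((k : ℝ) + 1) < η ∧ ∫ y, V.modulus k y ∂E.ν < ε / 8 := by
    obtain ⟨N, hN⟩ := exists_nat_one_div_lt hη
    obtain ⟨k, hk, hkN⟩ := ((V.tendsto_integral_modulus.eventually_lt_const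
      (by positivity : (0 : ℝ) < ε / 8)).and (eventually_ge_atTop N)).exists
    exact ⟨k, lt_of_le_of_lt (by gcongr) hN, hk⟩
  obtain ⟨J, hJ⟩ : ∃ J : Finset ℕ, ∀ θ : Θ, ∃ j ∈ J, dist θ (denseSeq Θ j) < 1 / ((k : ℝ) + 1) := by
    obtain ⟨J, hJ⟩ := isCompact_univ.elim_finite_subcover
      (fun j => Metric.ball (denseSeq Θ j) (1 / ((k : ℝ) + 1))) (fun j => Metric.isOpen_ball)
      (fun θ _ => by
        obtain ⟨j, hj⟩ := (denseRange_denseSeq Θ).exists_dist_lt θ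
          (by positivity : 0 < 1 / ((k : ℝ) + 1))
        exact Set.mem_iUnion.2 ⟨j, hj⟩)
    exact ⟨J, fun θ => by simpa using hJ (Set.mem_univ θ)⟩
  have hosc := (hx.osc k).eventually_lt_const (by positivity : (0 : ℝ) < ε / 8)
  have hfin : ∀ᶠ n : ℕ in atTop, ∀ j ∈ J, |(∑ i ∈ Finset.range n,
      V.logRatio (denseSeq Θ j) (x i).1 (x i).2) / n - V.averageKL σ (denseSeq Θ j)| < ε / 4 := by
    refine (Finset.eventually_all J).2 fun j _ => ?_
    have := Metric.tendsto_nhds.1 (hdense j) (ε / 4) (by positivity)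
    simpa only [Real.dist_eq] using this
  filter_upwards [hosc, hfin, eventually_gt_atTop 0] with n hn1 hn2 hn0 θ
  have hn0' : (0 : ℝ) < n := by exact_mod_cast hn0
  obtain ⟨j, hjJ, hj⟩ := hJ θ
  have h1 := hn2 j hjJ
  have h2 : |V.averageKL σ θ - V.averageKL σ (denseSeq Θ j)| < ε / 4 := hκ (hj.trans hk1)
  have h3 : |(∑ i ∈ Finset.range n, V.logRatio θ (x i).1 (x i).2) / n -
      (∑ i ∈ Finset.range n, V.logRatio (denseSeq Θ j) (x i).1 (x i).2) / n| < ε / 4 := by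
    have e1 : |∑ i ∈ Finset.range n, V.logRatio θ (x i).1 (x i).2 -
        ∑ i ∈ Finset.range n, V.logRatio (denseSeq Θ j) (x i).1 (x i).2| ≤
        ∑ i ∈ Finset.range n, V.osc k (x i).1 (x i).2 := by
      rw [← Finset.sum_sub_distrib]
      refine (Finset.abs_sum_le_sum_abs _ _).trans (Finset.sum_le_sum fun i _ => ?_)
      exact V.abs_logRatio_sub_le_osc (hx.mem i) (hx.q_ne_zero i) hj
    have e2 : (∑ i ∈ Finset.range n, ∫ y, V.osc k (x i).1 y ∂(E.Q (x i).1)) ≤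
        n * ∫ y, V.modulus k y ∂E.ν := by
      refine (Finset.sum_le_card_nsmul _ _ _ fun i _ => V.integral_osc_le k (x i).1).trans ?_
      simp
    rw [Finset.sum_sub_distrib, div_lt_iff₀ hn0'] at hn1
    rw [← sub_div, abs_div, abs_of_pos hn0', div_lt_iff₀ hn0']
    nlinarith
  rw [abs_lt] at *
  constructor <;> linarith [h1.1, h1.2, h2.1, h2.2, h3.1, h3.2]

end Oscillation

end Envelope

end LearningProblem

/-- Actions in the support of the limit are cluster points. -/
theorem mapClusterPt_of_mem_support {A : Type*} [MetricSpace A] [CompactSpace A]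
    [MeasurableSpace A] [BorelSpace A] {a : ℕ → A} {σ : ProbabilityMeasure A}
    (hσ : Tendsto (empiricalDistribution a) atTop (𝓝 σ)) {b : A}
    (hb : b ∈ (σ : Measure A).support) : MapClusterPt b atTop a := by
  rw [mapClusterPt_iff_frequently]
  intro s hs
  by_contra hcon
  rw [not_frequently] at hcon
  obtain ⟨ε, hε, hεs⟩ := Metric.mem_nhds_iff.1 hs
  -- A continuous function positive exactly on the ball. If the actions eventually avoid the ball,
  -- its averages tend to zero and the ball is `σ`-null.
  have hf : Continuous fun z => max 0 (ε - dist z b) := by fun_prop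
  have h1 := tendsto_average_of_tendsto_empiricalDistribution hσ hf
  have h2 : Tendsto (fun n => max 0 (ε - dist (a n) b)) atTop (𝓝 0) := by
    refine tendsto_const_nhds.congr' ?_
    filter_upwards [hcon] with n hn
    have : ¬ dist (a n) b < ε := fun h => hn (hεs h)
    rw [max_eq_left]
    linarith
  have h3 := h2.cesaro
  have h4 : ∫ z, max 0 (ε - dist z b) ∂(σ : Measure A) = 0 :=
    tendsto_nhds_unique h1 (h3.congr fun n => by rw [div_eq_inv_mul])
  have hi : Integrable (fun z => max 0 (ε - dist z b)) (σ : Measure A) :=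
    (BoundedContinuousFunction.mkOfCompact ⟨_, hf⟩).integrable _
  have h5 : (σ : Measure A) (Metric.ball b ε) = 0 := by
    refine measure_mono_null (fun z hz => ?_) (ae_iff.1 ((integral_eq_zero_iff_of_nonneg (fun z => le_max_left _ _) hi).1 h4))
    have : dist z b < ε := hz
    simp only [Pi.zero_apply, Set.mem_ofPred_eq]
    rw [max_eq_right (by linarith)]
    linarith
  exact (Measure.mem_support_iff_forall b |>.1 hb _ (Metric.ball_mem_nhds b hε)).ne' h5

namespace LearningProblem

namespace Envelope

variable {A Θ Y : Type*} [MetricSpace A] [CompactSpace A] [MeasurableSpace A] [BorelSpace A]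
  [MetricSpace Θ] [CompactSpace Θ] [MeasurableSpace Θ] [BorelSpace Θ] [MeasurableSpace Y]
  {E : LearningProblem A Θ Y} (V : E.Envelope)

/-! ### Concentration of beliefs -/

theorem measurable_ofReal_exp_logRatio (a : A) (y : Y) :
    Measurable fun θ => ENNReal.ofReal (Real.exp (-V.logRatio θ a y)) :=
  (Real.measurable_exp.comp (V.measurable_logRatio_left a y).neg).ennreal_ofReal

/-- The factor `q(y ∣ a)` does not depend on `θ`, so likelihoods may be replaced by likelihood
ratios. The constant is left unspecified because total mass one will control it. -/
theorem exists_bayes_eq {y : Y} (hy : y ∈ V.G) {a : A} (hq : E.q a y ≠ 0)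
    (μ : ProbabilityMeasure Θ) : ∃ c : ℝ≥0∞, (E.bayes μ a y : Measure Θ) =
      c • (μ : Measure Θ).withDensity fun θ => ENNReal.ofReal (Real.exp (-V.logRatio θ a y)) := by
  have h0 : E.likelihoodMeasure μ a y Set.univ ≠ 0 := fun h => by
    rw [likelihoodMeasure_univ, lintegral_eq_zero_iff
      (E.measurable_qm_left a y).coe_nnreal_ennreal] at h
    obtain ⟨θ, hθ⟩ := h.exists
    exact (V.qm_pos hy hq θ).ne' (by simpa using hθ)
  have h1 : E.likelihoodMeasure μ a y Set.univ ≠ ∞ := by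
    rw [← V.coe_evidence hy]; simp
  refine ⟨(E.likelihoodMeasure μ a y Set.univ)⁻¹ * E.q a y, ?_⟩
  have h2 : (E.bayes μ a y : Measure Θ) =
      (E.likelihoodMeasure μ a y Set.univ)⁻¹ • E.likelihoodMeasure μ a y := by
    simp [bayes, posterior, h0, h1]
  have h3 : E.likelihoodMeasure μ a y = (E.q a y : ℝ≥0∞) •
      (μ : Measure Θ).withDensity fun θ => ENNReal.ofReal (Real.exp (-V.logRatio θ a y)) := by
    rw [← withDensity_smul _ (V.measurable_ofReal_exp_logRatio a y), likelihoodMeasure]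
    congr 1
    funext θ
    rw [Pi.smul_apply, smul_eq_mul, ← ENNReal.ofReal_coe_nnreal, ← ENNReal.ofReal_coe_nnreal,
      ← ENNReal.ofReal_mul (NNReal.coe_nonneg _), V.qm_eq hy]
  rw [h2, mul_smul, ← h3]

theorem exists_belief_eq {x : ℕ → ProbabilityMeasure Θ × A × Y} {μ₀ : ProbabilityMeasure Θ}
    (h0 : (x 0).1 = μ₀) (hs : ∀ t, (x (t + 1)).1 = E.bayes (x t).1 (x t).2.1 (x t).2.2)
    (hG : ∀ t, (x t).2.2 ∈ V.G) (hq : ∀ t, E.q (x t).2.1 (x t).2.2 ≠ 0) (n : ℕ) :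
    ∃ c : ℝ≥0∞, ((x n).1 : Measure Θ) = c • (μ₀ : Measure Θ).withDensity fun θ =>
      ENNReal.ofReal (Real.exp (-∑ i ∈ Finset.range n, V.logRatio θ (x i).2.1 (x i).2.2)) := by
  induction n with
  | zero => exact ⟨1, by simp [h0]⟩
  | succ n ih =>
    obtain ⟨c, hc⟩ := ih
    obtain ⟨c', hc'⟩ := V.exists_bayes_eq (hG n) (hq n) (x n).1
    refine ⟨c' * c, ?_⟩
    have hm : Measurable fun θ => ENNReal.ofReal
        (Real.exp (-∑ i ∈ Finset.range n, V.logRatio θ (x i).2.1 (x i).2.2)) :=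
      (Real.measurable_exp.comp
        (Finset.measurable_fun_sum _ fun i _ => V.measurable_logRatio_left _ _).neg).ennreal_ofReal
    rw [hs n, hc', hc, withDensity_smul_measure, smul_smul,
      ← withDensity_mul _ hm (V.measurable_ofReal_exp_logRatio _ _)]
    congr 2
    funext θ
    rw [Pi.mul_apply, ← ENNReal.ofReal_mul (Real.exp_pos _).le, ← Real.exp_add,
      Finset.sum_range_succ, neg_add]

/-- An upper bound of the posterior probability of a set of parameters. -/
theorem measure_le_of_density {μ μ₀ : ProbabilityMeasure Θ} {c : ℝ≥0∞} {S : Θ → ℝ}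
    (hμ : (μ : Measure Θ) = c • (μ₀ : Measure Θ).withDensity fun θ =>
      ENNReal.ofReal (Real.exp (-S θ))) {s v : Set Θ} (hs : MeasurableSet s) (hv : MeasurableSet v)
    (h0 : (μ₀ : Measure Θ) v ≠ 0) {α β : ℝ} (hsα : ∀ θ ∈ s, α ≤ S θ) (hvβ : ∀ θ ∈ v, S θ ≤ β) :
    (μ : Measure Θ) s ≤ ENNReal.ofReal (Real.exp (β - α)) * ((μ₀ : Measure Θ) v)⁻¹ := by
  -- The unknown normalization `c` is bounded using only that `v` has posterior probability at most
  -- one.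
  have h1 : c * (ENNReal.ofReal (Real.exp (-β)) * (μ₀ : Measure Θ) v) ≤ 1 := by
    refine le_trans ?_ (prob_le_one (μ := (μ : Measure Θ)) (s := v))
    rw [hμ, Measure.smul_apply, smul_eq_mul, withDensity_apply _ hv, ← setLIntegral_const]
    gcongr c * ?_
    refine setLIntegral_mono' hv fun θ hθ => ?_
    exact ENNReal.ofReal_le_ofReal (Real.exp_le_exp.2 (neg_le_neg (hvβ θ hθ)))
  have h2 : (μ : Measure Θ) s ≤ c * ENNReal.ofReal (Real.exp (-α)) := by
    rw [hμ, Measure.smul_apply, smul_eq_mul, withDensity_apply _ hs]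
    gcongr c * ?_
    calc ∫⁻ θ in s, ENNReal.ofReal (Real.exp (-S θ)) ∂(μ₀ : Measure Θ)
        ≤ ∫⁻ _ in s, ENNReal.ofReal (Real.exp (-α)) ∂(μ₀ : Measure Θ) :=
          setLIntegral_mono' hs fun θ hθ =>
            ENNReal.ofReal_le_ofReal (Real.exp_le_exp.2 (neg_le_neg (hsα θ hθ)))
      _ ≤ ENNReal.ofReal (Real.exp (-α)) := by
          rw [setLIntegral_const]
          exact mul_le_of_le_one_right' prob_le_one
  have h3 : ENNReal.ofReal (Real.exp (-α)) =
      ENNReal.ofReal (Real.exp (β - α)) * ENNReal.ofReal (Real.exp (-β)) := by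
    rw [← ENNReal.ofReal_mul (Real.exp_pos _).le, ← Real.exp_add]
    ring_nf
  rw [← div_eq_mul_inv, ENNReal.le_div_iff_mul_le (Or.inl h0) (Or.inl (measure_ne_top _ _))]
  calc (μ : Measure Θ) s * (μ₀ : Measure Θ) v
      ≤ c * (ENNReal.ofReal (Real.exp (β - α)) * ENNReal.ofReal (Real.exp (-β))) *
        (μ₀ : Measure Θ) v := by rw [← h3]; gcongr
    _ = ENNReal.ofReal (Real.exp (β - α)) *
        (c * (ENNReal.ofReal (Real.exp (-β)) * (μ₀ : Measure Θ) v)) := by ring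
    _ ≤ ENNReal.ofReal (Real.exp (β - α)) := mul_le_of_le_one_right' h1

variable [Nonempty A] [Nonempty Θ]

/-- Beliefs assign vanishing probability to parameters away from the minimizers. -/
theorem tendsto_belief_zero {x : ℕ → ProbabilityMeasure Θ × A × Y} {μ₀ : ProbabilityMeasure Θ}
    (hμ₀ : (μ₀ : Measure Θ).IsOpenPosMeasure) (h0 : (x 0).1 = μ₀)
    (hs : ∀ t, (x (t + 1)).1 = E.bayes (x t).1 (x t).2.1 (x t).2.2)
    (hx : V.IsTypical fun t => (x t).2) {σ : ProbabilityMeasure A}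
    (hσ : Tendsto (empiricalDistribution fun t => (x t).2.1) atTop (𝓝 σ)) {θ₀ : Θ}
    {η : ℝ} (hη : 0 < η) :
    Tendsto (fun n => ((x n).1 : Measure Θ) {θ | V.averageKL σ θ₀ + η < V.averageKL σ θ}) atTop
      (𝓝 0) := by
  have hc := V.continuous_averageKL σ
  set s : Set Θ := {θ | V.averageKL σ θ₀ + η < V.averageKL σ θ}
  set v : Set Θ := {θ | V.averageKL σ θ < V.averageKL σ θ₀ + η / 4}
  have hso : IsOpen s := isOpen_lt continuous_const hc
  have hvo : IsOpen v := isOpen_lt hc continuous_const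
  have hv0 : (μ₀ : Measure Θ) v ≠ 0 :=
    hμ₀.open_pos v hvo ⟨θ₀, by simp only [v, Set.mem_ofPred_eq]; linarith⟩
  have hlim : Tendsto (fun n : ℕ => ENNReal.ofReal (Real.exp (-(n * (η / 4)))) *
      ((μ₀ : Measure Θ) v)⁻¹) atTop (𝓝 0) := by
    have h1 : Tendsto (fun n : ℕ => Real.exp (-(n * (η / 4)))) atTop (𝓝 0) :=
      Real.tendsto_exp_neg_atTop_nhds_zero.comp
        (tendsto_natCast_atTop_atTop.atTop_mul_const (by positivity))
    have h2 := ENNReal.tendsto_ofReal h1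
    rw [ENNReal.ofReal_zero] at h2
    have h3 := ENNReal.Tendsto.mul_const (b := ((μ₀ : Measure Θ) v)⁻¹) h2
      (Or.inr (ENNReal.inv_ne_top.2 hv0))
    rwa [zero_mul] at h3
  refine tendsto_of_tendsto_of_tendsto_of_le_of_le' tendsto_const_nhds hlim
    (Eventually.of_forall fun _ => zero_le) ?_
  filter_upwards [hx.eventually_abs_sub_lt hσ (by positivity : 0 < η / 4),
    eventually_gt_atTop 0] with n hn hn0
  have hn0' : (0 : ℝ) < n := by exact_mod_cast hn0
  obtain ⟨c, hc⟩ := V.exists_belief_eq h0 hs hx.mem hx.q_ne_zero n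
  -- With uniform error `η / 4`, the normalized sum exceeds the value at `θ₀` by at least `η - η /
  -- 4` on `s` and by at most `η / 4 + η / 4` on `v`. The gap `η / 4` is the exponential rate.
  have h := measure_le_of_density hc hso.measurableSet hvo.measurableSet hv0
    (α := n * (V.averageKL σ θ₀ + 3 * (η / 4))) (β := n * (V.averageKL σ θ₀ + 2 * (η / 4)))
    (fun θ hθ => ?_) (fun θ hθ => ?_)
  · refine h.trans (le_of_eq ?_)
    ring_nf
  · have h1 := (abs_lt.1 (hn θ)).1
    have h2 : V.averageKL σ θ₀ + η < V.averageKL σ θ := hθ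
    rw [mul_comm, ← le_div_iff₀ hn0']
    linarith
  · have h1 := (abs_lt.1 (hn θ)).2
    have h2 : V.averageKL σ θ < V.averageKL σ θ₀ + η / 4 := hθ
    rw [mul_comm, ← div_le_iff₀ hn0']
    linarith

/-- Limit beliefs are concentrated on the minimizers. -/
theorem ae_mem_klMinimizers {x : ℕ → ProbabilityMeasure Θ × A × Y} {μ₀ : ProbabilityMeasure Θ}
    (hμ₀ : (μ₀ : Measure Θ).IsOpenPosMeasure) (h0 : (x 0).1 = μ₀)
    (hs : ∀ t, (x (t + 1)).1 = E.bayes (x t).1 (x t).2.1 (x t).2.2)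
    (hx : V.IsTypical fun t => (x t).2) {σ : ProbabilityMeasure A}
    (hσ : Tendsto (empiricalDistribution fun t => (x t).2.1) atTop (𝓝 σ))
    {u : ℕ → ℕ} (hu : Tendsto u atTop atTop) {μ : ProbabilityMeasure Θ}
    (hμ : Tendsto (fun j => (x (u j)).1) atTop (𝓝 μ)) :
    ∀ᵐ θ ∂(μ : Measure Θ), θ ∈ E.klMinimizers σ := by
  have hc := V.continuous_averageKL σ
  obtain ⟨θ₀, -, hθ₀⟩ := isCompact_univ.exists_isMinOn Set.univ_nonempty hc.continuousOn
  have hmin : ∀ θ, V.averageKL σ θ₀ ≤ V.averageKL σ θ := fun θ => hθ₀ (Set.mem_univ θ)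
  have h1 : ∀ k : ℕ, ∀ᵐ θ ∂(μ : Measure Θ),
      V.averageKL σ θ ≤ V.averageKL σ θ₀ + 1 / ((k : ℝ) + 1) := by
    intro k
    have hη : 0 < 1 / ((k : ℝ) + 1) := by positivity
    have h2 := (V.tendsto_belief_zero hμ₀ h0 hs hx hσ (θ₀ := θ₀) hη).comp hu
    -- Portmanteau: the strict superlevel set is open, so the limit gives it no more mass than the
    -- liminf, which is zero.
    have h3 := ProbabilityMeasure.le_liminf_measure_open_of_tendsto hμ
      (isOpen_lt (continuous_const (y := V.averageKL σ θ₀ + 1 / ((k : ℝ) + 1))) hc)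
    have h4 := h2.liminf_eq
    simp only [Function.comp_def] at h4
    rw [h4] at h3
    have h5 := le_antisymm h3 zero_le
    rw [ae_iff]
    simpa only [not_le] using h5
  filter_upwards [ae_all_iff.2 h1] with θ hθ
  rw [V.mem_klMinimizers_iff]
  intro θ'
  refine le_trans ?_ (hmin θ')
  have h2 : Tendsto (fun k : ℕ => V.averageKL σ θ₀ + 1 / ((k : ℝ) + 1)) atTop
      (𝓝 (V.averageKL σ θ₀)) := by
    simpa using (tendsto_one_div_add_atTop_nhds_zero_nat (𝕜 := ℝ)).const_add (V.averageKL σ θ₀)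
  exact ge_of_tendsto' h2 hθ

theorem isClosed_klMinimizers (V : E.Envelope) (σ : ProbabilityMeasure A) : IsClosed (E.klMinimizers σ) := by
  have h : E.klMinimizers σ = ⋂ θ', {θ | V.averageKL σ θ ≤ V.averageKL σ θ'} := by
    ext θ
    simp [V.mem_klMinimizers_iff]
  rw [h]
  exact isClosed_iInter fun θ' => isClosed_le (V.continuous_averageKL σ) continuous_const

/-! ### Equilibrium -/

/-- The optimality correspondence has a closed graph. -/
theorem isClosed_dynamicOptimal (V : E.Envelope) {δ : ℝ} {W : ProbabilityMeasure Θ → ℝ}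
    (hWc : Continuous W) :
    IsClosed {p : ProbabilityMeasure Θ × A | p.2 ∈ E.dynamicOptimal δ W p.1} := by
  have hd := V.continuous_dynamicPayoff δ hWc
  have h : {p : ProbabilityMeasure Θ × A | p.2 ∈ E.dynamicOptimal δ W p.1} =
      ⋂ a', {p | E.dynamicPayoff δ W p.1 a' ≤ E.dynamicPayoff δ W p.1 p.2} := by
    ext p
    simp [dynamicOptimal]
  rw [h]
  refine isClosed_iInter fun a' => isClosed_le ?_ hd
  exact hd.comp (g := fun p : ProbabilityMeasure Θ × A => E.dynamicPayoff δ W p.1 p.2)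
    (f := fun p : ProbabilityMeasure Θ × A => (p.1, a')) (by fun_prop)

theorem mem_dynamicOptimal_of_tendsto (V : E.Envelope) {δ : ℝ} {W : ProbabilityMeasure Θ → ℝ}
    (hWc : Continuous W) {m : ℕ → ProbabilityMeasure Θ} {a : ℕ → A} {μ : ProbabilityMeasure Θ}
    {b : A} (hm : Tendsto m atTop (𝓝 μ)) (ha : Tendsto a atTop (𝓝 b))
    (h : ∀ j, a j ∈ E.dynamicOptimal δ W (m j)) : b ∈ E.dynamicOptimal δ W μ := by
  have hlim : Tendsto (fun j => (m j, a j)) atTop (𝓝 (μ, b)) := hm.prodMk_nhds ha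
  have hmem : (μ, b) ∈ {p : ProbabilityMeasure Θ × A | p.2 ∈ E.dynamicOptimal δ W p.1} :=
    IsClosed.mem_of_tendsto (V.isClosed_dynamicOptimal hWc) hlim (Eventually.of_forall h)
  exact hmem

/-- Every action in the support of the limit of the empirical distributions is myopically optimal
for some belief concentrated on the minimizers. -/
theorem exists_myopicOptimal {δ : ℝ} (hδ : δ ∈ Set.Ioo (0 : ℝ) 1)
    {W : ProbabilityMeasure Θ → ℝ} (hW : E.IsValueFunction δ W) (hWc : Continuous W)
    {x : ℕ → ProbabilityMeasure Θ × A × Y} {μ₀ : ProbabilityMeasure Θ}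
    (hμ₀ : (μ₀ : Measure Θ).IsOpenPosMeasure) (h0 : (x 0).1 = μ₀)
    (hs : ∀ t, (x (t + 1)).1 = E.bayes (x t).1 (x t).2.1 (x t).2.2)
    (hx : V.IsTypical fun t => (x t).2) (hopt : ∀ t, (x t).2.1 ∈ E.dynamicOptimal δ W (x t).1)
    {σ : ProbabilityMeasure A}
    (hσ : Tendsto (empiricalDistribution fun t => (x t).2.1) atTop (𝓝 σ))
    (hid : E.WeakIdentification σ) {b : A} (hb : b ∈ (σ : Measure A).support) :
    ∃ μ : ProbabilityMeasure Θ, (∀ᵐ θ ∂(μ : Measure Θ), θ ∈ E.klMinimizers σ) ∧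
      b ∈ E.myopicOptimal μ := by
  -- First the actions converge to `b` along a subsequence, then the beliefs in the same periods by
  -- compactness.
  obtain ⟨u, hu, hub⟩ := (mapClusterPt_of_mem_support hσ hb).tendsto_subseq
  obtain ⟨μ, w, hw, hμ⟩ := CompactSpace.tendsto_subseq fun j => (x (u j)).1
  have hμ' : Tendsto (fun j => (x (u (w j))).1) atTop (𝓝 μ) := hμ
  have hb' : Tendsto (fun j => (x (u (w j))).2.1) atTop (𝓝 b) := hub.comp hw.tendsto_atTop
  have huw : Tendsto (fun j => u (w j)) atTop atTop := hu.tendsto_atTop.comp hw.tendsto_atTop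
  have hmin := V.ae_mem_klMinimizers hμ₀ h0 hs hx hσ huw hμ'
  refine ⟨μ, hmin, ?_⟩
  have hba : b ∈ E.dynamicOptimal δ W μ :=
    V.mem_dynamicOptimal_of_tendsto hWc hμ' hb' fun j => hopt (u (w j))
  obtain ⟨θ₀, hθ₀⟩ := hmin.exists
  refine V.mem_myopicOptimal hδ hW hba (θ₀ := θ₀) ?_
  filter_upwards [hmin] with θ hθ
  exact hid θ hθ θ₀ hθ₀ b hb

/-- The belief attached to one action `a₀` of the support serves for all. For `b` in the support,
the belief attached to `b` ranks `b` at least as high as `a₀`; both payoffs are constant on the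
minimizers, so the belief attached to `a₀` does so too. -/
theorem isBerkNash_of_tendsto {δ : ℝ} (hδ : δ ∈ Set.Ioo (0 : ℝ) 1)
    {W : ProbabilityMeasure Θ → ℝ} (hW : E.IsValueFunction δ W) (hWc : Continuous W)
    {x : ℕ → ProbabilityMeasure Θ × A × Y} {μ₀ : ProbabilityMeasure Θ}
    (hμ₀ : (μ₀ : Measure Θ).IsOpenPosMeasure) (h0 : (x 0).1 = μ₀)
    (hs : ∀ t, (x (t + 1)).1 = E.bayes (x t).1 (x t).2.1 (x t).2.2)
    (hx : V.IsTypical fun t => (x t).2) (hopt : ∀ t, (x t).2.1 ∈ E.dynamicOptimal δ W (x t).1)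
    {σ : ProbabilityMeasure A}
    (hσ : Tendsto (empiricalDistribution fun t => (x t).2.1) atTop (𝓝 σ))
    (hid : E.WeakIdentification σ) : E.IsBerkNash σ := by
  have hex : ∀ b ∈ (σ : Measure A).support, ∃ μ : ProbabilityMeasure Θ,
      (∀ᵐ θ ∂(μ : Measure Θ), θ ∈ E.klMinimizers σ) ∧ b ∈ E.myopicOptimal μ := fun b hb =>
    V.exists_myopicOptimal hδ hW hWc hμ₀ h0 hs hx hopt hσ hid hb
  obtain ⟨a₀, ha₀⟩ : (σ : Measure A).support.Nonempty :=
    Measure.nonempty_support (IsProbabilityMeasure.ne_zero _)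
  obtain ⟨μ, hμ, hμa⟩ := hex a₀ ha₀
  obtain ⟨θ₀, hθ₀⟩ := hμ.exists
  have hconst : ∀ b ∈ (σ : Measure A).support, ∀ μ : ProbabilityMeasure Θ,
      (∀ᵐ θ ∂(μ : Measure Θ), θ ∈ E.klMinimizers σ) →
      ∫ θ, E.expectedPayoff b θ ∂(μ : Measure Θ) = E.expectedPayoff b θ₀ := by
    intro b hb μ hμ
    have h : ∀ᵐ θ ∂(μ : Measure Θ), E.expectedPayoff b θ = E.expectedPayoff b θ₀ := by
      filter_upwards [hμ] with θ hθ
      rw [expectedPayoff, expectedPayoff, hid θ hθ θ₀ hθ₀ b hb]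
    rw [integral_congr_ae h]
    simp
  refine ⟨μ, fun b hb a' => ?_,
    Measure.support_subset_of_isClosed (V.isClosed_klMinimizers σ) hμ⟩
  obtain ⟨μ', hμ', hμb⟩ := hex b hb
  have h1 := hμb a₀
  rw [hconst a₀ ha₀ μ' hμ', hconst b hb μ' hμ'] at h1
  have h2 := hμa a'
  rw [hconst a₀ ha₀ μ hμ] at h2
  rw [hconst b hb μ hμ]
  exact h2.trans h1

/-- The closed graph supplies the measurability needed to pass from the choice kernels to the path
law. -/
theorem ae_mem_dynamicOptimal (V : E.Envelope) {δ : ℝ} {W : ProbabilityMeasure Θ → ℝ} (hWc : Continuous W)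
    (φ : ℕ → Kernel (ProbabilityMeasure Θ) A) [∀ t, IsMarkovKernel (φ t)]
    (hφ : ∀ t μ, φ t μ (E.dynamicOptimal δ W μ) = 1) (μ₀ : ProbabilityMeasure Θ) :
    ∀ᵐ ω ∂(E.pathLaw φ μ₀), ∀ t, (ω t).2.1 ∈ E.dynamicOptimal δ W (ω t).1 := by
  let := TopologicalSpace.metrizableSpaceMetric (ProbabilityMeasure Θ)
  have hcl := V.isClosed_dynamicOptimal (δ := δ) hWc
  have hm : MeasurableSet {z : ProbabilityMeasure Θ × A × Y |
      z.2.1 ∈ E.dynamicOptimal δ W z.1} :=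
    (measurable_fst.prodMk (measurable_fst.comp measurable_snd)) hcl.measurableSet
  refine E.ae_pathLaw_forall φ μ₀ (p := fun _ z => z.2.1 ∈ E.dynamicOptimal δ W z.1) (fun _ => hm)
    fun t μ => (E.ae_period_iff (φ t) μ hm).2 ?_
  have hmμ : MeasurableSet (E.dynamicOptimal δ W μ) :=
    (measurable_prodMk_left (x := μ)) hcl.measurableSet
  have h1 : ∀ᵐ a ∂(φ t μ), a ∈ E.dynamicOptimal δ W μ :=
    (mem_ae_iff_prob_eq_one hmμ).2 (hφ t μ)
  filter_upwards [h1] with a ha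
  exact Eventually.of_forall fun _ => ha

end Envelope

/-! ### Conclusions for regular problems -/

variable {A Θ Y : Type*} [MetricSpace A] [CompactSpace A] [MeasurableSpace A] [BorelSpace A]
  [MetricSpace Θ] [CompactSpace Θ] [MeasurableSpace Θ] [BorelSpace Θ] [MeasurableSpace Y]
  {E : LearningProblem A Θ Y}

theorem Regular.existsUnique_valueFunction [Nonempty A] (hE : E.Regular) {δ : ℝ}
    (hδ : δ ∈ Set.Ioo (0 : ℝ) 1) : ∃! W : ProbabilityMeasure Θ → ℝ, E.IsValueFunction δ W := by
  obtain ⟨V⟩ := hE.nonempty_envelope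
  obtain ⟨W, -, hW⟩ := V.exists_continuous_valueFunction hδ
  exact ⟨W, hW, fun W' hW' => V.valueFunction_unique hδ hW' hW⟩

theorem Regular.ae_isBerkNash [Nonempty A] [Nonempty Θ] (hE : E.Regular) {δ : ℝ}
    (hδ : δ ∈ Set.Ioo (0 : ℝ) 1) {W : ProbabilityMeasure Θ → ℝ} (hW : E.IsValueFunction δ W)
    {μ₀ : ProbabilityMeasure Θ} (hμ₀ : (μ₀ : Measure Θ).IsOpenPosMeasure)
    (φ : ℕ → Kernel (ProbabilityMeasure Θ) A) [∀ t, IsMarkovKernel (φ t)]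
    (hφ : ∀ t μ, φ t μ (E.dynamicOptimal δ W μ) = 1) :
    ∀ᵐ ω ∂(E.pathLaw φ μ₀), ∀ σ : ProbabilityMeasure A,
      Tendsto (empiricalDistribution fun t => (ω t).2.1) atTop (𝓝 σ) →
      E.WeakIdentification σ → E.IsBerkNash σ := by
  obtain ⟨V⟩ := hE.nonempty_envelope
  let := TopologicalSpace.metrizableSpaceMetric (ProbabilityMeasure Θ)
  -- Uniqueness among bounded measurable solutions identifies `W` with the continuous fixed point.
  have hWc : Continuous W := by
    obtain ⟨W', hc, hW'⟩ := V.exists_continuous_valueFunction hδ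
    rwa [V.valueFunction_unique hδ hW hW']
  filter_upwards [V.ae_isTypical φ μ₀, E.ae_pathLaw_belief φ μ₀,
    V.ae_mem_dynamicOptimal hWc φ hφ μ₀] with ω h1 h2 h3 σ hσ hid
  exact V.isBerkNash_of_tendsto hδ hW hWc hμ₀ h2.1 h2.2 h1 h3 hσ hid

end LearningProblem

theorem mainTheorem8 {k l m : ℕ}
    (𝔸 : Set (EuclideanSpace ℝ (Fin k))) (Θ : Set (EuclideanSpace ℝ (Fin l)))
    (𝕐 : Set (EuclideanSpace ℝ (Fin m)))
    (hA_ne : 𝔸.Nonempty) (hA : IsCompact 𝔸) (hΘ_ne : Θ.Nonempty) (hΘ : IsCompact Θ)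
    (hY : MeasurableSet 𝕐)
    (E : LearningProblem 𝔸 Θ 𝕐) (hE : E.Regular)
    (δ : ℝ) (hδ : δ ∈ Set.Ioo (0 : ℝ) 1) :
    (∃! W : ProbabilityMeasure Θ → ℝ, E.IsValueFunction δ W) ∧
    ∀ W : ProbabilityMeasure Θ → ℝ, E.IsValueFunction δ W →
    ∀ μ₀ : ProbabilityMeasure Θ, (μ₀ : Measure Θ).IsOpenPosMeasure →
    ∀ (φ : ℕ → Kernel (ProbabilityMeasure Θ) 𝔸) [∀ t, IsMarkovKernel (φ t)],
    (∀ t μ, φ t μ (E.dynamicOptimal δ W μ) = 1) →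
    ∀ᵐ ω ∂(E.pathLaw φ μ₀), ∀ σ : ProbabilityMeasure 𝔸,
      Tendsto (empiricalDistribution fun t => (ω t).2.1) atTop (𝓝 σ) →
      E.WeakIdentification σ → E.IsBerkNash σ := by
  have : CompactSpace 𝔸 := isCompact_iff_compactSpace.1 hA
  have : CompactSpace Θ := isCompact_iff_compactSpace.1 hΘ
  have : Nonempty 𝔸 := hA_ne.to_subtype
  have : Nonempty Θ := hΘ_ne.to_subtype
  exact ⟨hE.existsUnique_valueFunction hδ, fun W hW μ₀ hμ₀ φ _ hφ =>
    hE.ae_isBerkNash hδ hW hμ₀ φ hφ⟩
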